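/- Let $N\ge 2$ and $\bar m\ge 2$ be integers, $m_1=\bar m-1$. Binomial coefficients $\binom{n}{m}$ vanish if $m>n$ or $m<0$, empty sums are $0$, empty products are $1$, and $(a)_m=a(a+1)\cdots(a+m-1)$. For $1\le n,m\le N$ put $\beta^{(1)}_{nm}=\binom{m_1}{n-m}$ if $m\le n-1$, $\beta^{(1)}_{nm}=0$ if $m\ge n$, and $$\beta^{(k)}_{nm}=-\sum_{j=m+1}^{n+1-k}\binom{m_1}{j-m}\beta^{(k-1)}_{nj}\quad(k\ge 2),\qquad \alpha_{nm}=(-1)^{n+m+1}\sum_{k=1}^{n-m}\beta^{(k)}_{nm},$$ $$\gamma_n=\sum_{j=1}^{n-1}(-1)^j\binom{m_1}{j}\alpha_{nj}+(-1)^n\binom{m_1}{n}.$$ For vectors $x,\dot x,y,\dot y,\ddot y\in\mathbb C^N$ with $x_1,\dots,x_N$ distinct define $$h_1^{(2)}=-\Big[(m_1+1)!\prod_{\ell=2}^N(x_1-x_\ell)\Big]^{-1}\sum_{j=1}^N(N-j+1)_{m_1}x_1^{N-j}\ddot y_j+\dot x_1\sum_{n=2}^N\frac{m_1\dot x_1+2\dot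 x_n}{x_1-x_n}$$ and, for $2\le n\le N$, $$\begin{aligned}h_n^{(2)}=&\sum_{\ell\ne n}\frac{2\dot x_n\dot x_\ell}{x_n-x_\ell}-\Big[\prod_{\ell\ne n}(x_n-x_\ell)\Big]^{-1}\Big\{\sum_{m=1}^Nx_n^{N-m}\ddot y_m+\sum_{m=1}^N\sum_{j=1}^{m-1}\alpha_{mj}x_n^{N-m}x_1^{m-j}\ddot y_j\\&-\dot x_1^2\sum_{m=1}^Nm(m-1)\gamma_mx_n^{N-m}x_1^{m-2}+\dot x_1^2\sum_{m=1}^N\sum_{j=1}^{m-2}(m-j)(m-j-1)\alpha_{mj}x_n^{N-m}x_1^{m-j-2}y_j\\&+2\dot x_1\sum_{m=1}^N\sum_{j=1}^{m-1}(m-j)\alpha_{mj}x_n^{N-m}x_1^{m-j-1}\dot y_j\Big\}\\&+\Big\{(x_n-x_1)^{-2}\Big[(m_1+1)!\prod_{\ell=2,\,\ell\ne n}^N(x_n-x_\ell)(x_1-x_\ell)\Big]^{-1}\sum_{j=1}^N(N-j+1)_{m_1}x_1^{N-j}\ddot y_j\\&\quad+\dot x_1\Big[\prod_{\ell\ne n}(x_n-x_\ell)\Big]^{-1}\sum_{j=2}^N\frac{m_1\dot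 x_1+2\dot x_j}{x_1-x_j}\Big\}\\&\quad\cdot\Big\{\sum_{m=1}^Nm\gamma_mx_n^{N-m}x_1^{m-1}-\sum_{m=1}^N\sum_{j=1}^{m-1}(m-j)\alpha_{mj}x_n^{N-m}x_1^{m-j-1}y_j\Big\},\end{aligned}$$ where $\ell$ runs over $\{1,\dots,N\}\setminus\{n\}$ in the sums and products over $\ell\neq n$, and the term $m(m-1)\gamma_m x_n^{N-m}x_1^{m-2}$ is $0$ for $m=1$. (a) Let $x_1(t),\dots,x_N(t)$ be complex-valued, twice differentiable and pairwise distinct for $t$ in an open set of real times, and let $y_1(t),\dots,y_N(t)$ be the first $N$ coefficients of $$(z-x_1)^{m_1}\prod_{n=1}^N(z-x_n)=z^{N+m_1}+\sum_{n=1}^{N+m_1}y_nz^{N+m_1-n},$$ a polynomial with the root $x_1$ of multiplicity $\bar m$ and the simple roots $x_2,\dots,x_N$. Then $y_1,\dots,y_N$ are twice differentiable and $$\ddot x_n=h_n^{(2)}(x;\dot x;y;\dot y;\ddot y),\qquad 1\le n\le N.$$ (b) Call a second-order system $\ddot z=F(z,\dot z)$ in $\mathbb C^N$, considered for $(z,\dot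 z)$ in a set $D\subseteq\mathbb C^N\times\mathbb C^N$, algebraically solvable over a class $\mathcal K$ of functions of the time $t$ and the initial time $t_0$ (the functions of time that are regarded as known) if: every initial value problem $z(t_0)=z^{(0)}$, $\dot z(t_0)=z^{(1)}$ with $(z^{(0)},z^{(1)})\in D$ has a solution on some open interval that contains $t_0$; any two solutions of it coincide on the common part of their intervals; and each component $z_n(t)$, as a function of the solution, of $t_0$ and of $t$, belongs to the smallest class of functions that contains the functions in $\mathcal K$, the initial data $z_k(t_0)$, $\dot z_k(t_0)$ and the complex constants, and is closed under sums, products, reciprocals of nowhere vanishing functions, and extraction of a root, continuous in $t$, of a monic polynomial in one variable with coefficients in the class. If the system $\ddot y_n=f_n(y,\dot y)$, $1\le n\le N$, considered for $(y,\dot y)\in U\subseteq\mathbb C^N\times\mathbb C^N$, is algebraically solvable over $\mathcal K$, then so is the $N$-body problem $$\ddot x_n=h_n^{(2)}\big(x;\dot x;y;\dot y;f(y,\dot y)\big),\quad y_j=(-1)^j\sigma_j,\quad \dot y_j=(-1)^j\sum_{k=1}^N\frac{\partial\sigma_j}{\partial x_k}\dot x_k,\qquad 1\le n,j\le N,$$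 considered for $x_1,\dots,x_N$ distinct and $(y,\dot y)\in U$. Here $\sigma_j=\sigma_j(x_1,\dots,x_1,x_1,\dots,x_N)$ is the $j$-th elementary symmetric polynomial in $N+m_1$ arguments, with $x_1$ repeated $m_1$ additional times. -/

import Mathlib

open Finset Polynomial

namespace MultipleRoot

/-! ### The integer coefficients -/

/-- `beta m₁ n k m` is the integer `β_{nm}^{(k)}`, defined by recursion on `k ≥ 1`
(the value at `k = 0` is never used). -/
def beta (m₁ n : ℕ) : ℕ → ℕ → ℤ
  | 0, _ => 0
  | 1, m => if m < n then (m₁.choose (n - m) : ℤ) else 0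
  | k + 2, m =>
      -∑ j ∈ Icc (m + 1) (n + 1 - (k + 2)), (m₁.choose (j - m) : ℤ) * beta m₁ n (k + 1) j

/-- `alpha m₁ n m` is `α_{nm} = (-1)^{n+m+1} ∑_{k=1}^{n-m} β_{nm}^{(k)}`. -/
def alpha (m₁ n m : ℕ) : ℤ :=
  (-1) ^ (n + m + 1) * ∑ k ∈ Icc 1 (n - m), beta m₁ n k m

/-- `gamma m₁ n` is `γ_n = ∑_{j=1}^{n-1} (-1)^j (m₁ choose j) α_{nj} + (-1)^n (m₁ choose n)`. -/
def gamma (m₁ n : ℕ) : ℤ :=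
  ∑ j ∈ Icc 1 (n - 1), (-1) ^ j * (m₁.choose j : ℤ) * alpha m₁ n j
    + (-1) ^ n * (m₁.choose n : ℤ)

noncomputable section

/-! ### The functions `h_n^{(2)}`

In the formulas a vector is a sequence `ℕ → ℂ` of which only the entries `1, …, N` are used. -/

/-- The entries of a vector `(x_1, …, x_N)`, numbered from `1` to `N`. -/
def ent {N : ℕ} (x : Fin N → ℂ) (k : ℕ) : ℂ :=
  if h : 1 ≤ k ∧ k ≤ N then x ⟨k - 1, by omega⟩ else 0

/-- The sum `∑_{j=1}^N (N-j+1)_{m₁} x_1^{N-j} w_j`, where `(a)_m = a (a+1) ⋯ (a+m-1)`. -/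
def pochSum (N m₁ : ℕ) (x w : ℕ → ℂ) : ℂ :=
  ∑ j ∈ Icc 1 N, ((N - j + 1).ascFactorial m₁ : ℂ) * x 1 ^ (N - j) * w j

/-- `h_1^{(2)}`; `xd`, `ydd` stand for `ẋ`, `ÿ`. -/
def hFirst (N m₁ : ℕ) (x xd ydd : ℕ → ℂ) : ℂ :=
  -(((m₁ + 1).factorial : ℂ) * ∏ l ∈ Icc 2 N, (x 1 - x l))⁻¹ * pochSum N m₁ x ydd
    + xd 1 * ∑ n ∈ Icc 2 N, (m₁ * xd 1 + 2 * xd n) / (x 1 - x n)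

/-- `h_n^{(2)}` for `2 ≤ n ≤ N`; `xd`, `yd`, `ydd` stand for `ẋ`, `ẏ`, `ÿ`. -/
def hOther (N m₁ n : ℕ) (x xd y yd ydd : ℕ → ℂ) : ℂ :=
  ∑ l ∈ (Icc 1 N).erase n, 2 * xd n * xd l / (x n - x l)
  - (∏ l ∈ (Icc 1 N).erase n, (x n - x l))⁻¹ *
    ( ∑ m ∈ Icc 1 N, x n ^ (N - m) * ydd m
      + ∑ m ∈ Icc 1 N, ∑ j ∈ Icc 1 (m - 1),
          (alpha m₁ m j : ℂ) * x n ^ (N - m) * x 1 ^ (m - j) * ydd j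
      - xd 1 ^ 2 * ∑ m ∈ Icc 1 N,
          (m : ℂ) * ((m : ℂ) - 1) * (gamma m₁ m : ℂ) * x n ^ (N - m) * x 1 ^ (m - 2)
      + xd 1 ^ 2 * ∑ m ∈ Icc 1 N, ∑ j ∈ Icc 1 (m - 2),
          ((m : ℂ) - j) * ((m : ℂ) - j - 1) * (alpha m₁ m j : ℂ)
            * x n ^ (N - m) * x 1 ^ (m - j - 2) * y j
      + 2 * xd 1 * ∑ m ∈ Icc 1 N, ∑ j ∈ Icc 1 (m - 1),
          ((m : ℂ) - j) * (alpha m₁ m j : ℂ) * x n ^ (N - m) * x 1 ^ (m - j - 1) * yd j )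
  + ( ((x n - x 1) ^ 2)⁻¹
        * (((m₁ + 1).factorial : ℂ)
            * ∏ l ∈ (Icc 2 N).erase n, ((x n - x l) * (x 1 - x l)))⁻¹
        * pochSum N m₁ x ydd
      + xd 1 * (∏ l ∈ (Icc 1 N).erase n, (x n - x l))⁻¹
        * ∑ j ∈ Icc 2 N, (m₁ * xd 1 + 2 * xd j) / (x 1 - x j) )
    * ( ∑ m ∈ Icc 1 N, (m : ℂ) * (gamma m₁ m : ℂ) * x n ^ (N - m) * x 1 ^ (m - 1)
      - ∑ m ∈ Icc 1 N, ∑ j ∈ Icc 1 (m - 1),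
          ((m : ℂ) - j) * (alpha m₁ m j : ℂ) * x n ^ (N - m) * x 1 ^ (m - j - 1) * y j )

/-- The vector `(h_1^{(2)}, …, h_N^{(2)})` as a function of `x`, `ẋ` and `y^{(N)}`, `ẏ^{(N)}`,
`ÿ^{(N)}`. -/
def h {N : ℕ} (m₁ : ℕ) (x xd y yd ydd : Fin N → ℂ) : Fin N → ℂ := fun i =>
  if (i : ℕ) + 1 = 1 then hFirst N m₁ (ent x) (ent xd) (ent ydd)
  else hOther N m₁ (i + 1) (ent x) (ent xd) (ent y) (ent yd) (ent ydd)

/-! ### The polynomial and its first `N` coefficients -/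

/-- The polynomial `(z - x_1)^{m₁} ∏_{n=1}^N (z - x_n)`. -/
def rootPoly {N : ℕ} (m₁ : ℕ) (x : Fin N → ℂ) : ℂ[X] :=
  (X - C (ent x 1)) ^ m₁ * ∏ n, (X - C (x n))

/-- The first `N` coefficients `y_1, …, y_N` of
`(z - x_1)^{m₁} ∏ (z - x_n) = z^{N+m₁} + ∑_{n=1}^{N+m₁} y_n z^{N+m₁-n}`. -/
def firstCoeffs {N : ℕ} (m₁ : ℕ) (x : Fin N → ℂ) : Fin N → ℂ := fun j =>
  (rootPoly m₁ x).coeff (N + m₁ - (j + 1))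

/-- `y_j = (-1)^j σ_j(x_1, …, x_1, x_1, …, x_N)` for `1 ≤ j ≤ N`, where `x_1` is repeated `m₁`
additional times and `σ_j` is the elementary symmetric polynomial of degree `j`. -/
def vieta {N : ℕ} (m₁ : ℕ) (x : Fin N → ℂ) : Fin N → ℂ := fun j =>
  (-1) ^ ((j : ℕ) + 1) *
    (Multiset.replicate m₁ (ent x 1) + (univ : Finset (Fin N)).val.map x).esymm (j + 1)

/-- `ẏ_j = (-1)^j ∑_{k=1}^N (∂/∂x_k) [σ_j(x_1, …, x_1, x_1, …, x_N)] ẋ_k`. -/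
def vietaDot {N : ℕ} (m₁ : ℕ) (x xd : Fin N → ℂ) : Fin N → ℂ := fun j =>
  (-1) ^ ((j : ℕ) + 1) * ∑ k : Fin N,
    deriv (fun s : ℂ =>
      (Multiset.replicate m₁ (ent (Function.update x k s) 1)
        + (univ : Finset (Fin N)).val.map (Function.update x k s)).esymm (j + 1)) (x k) * xd k

/-! ### Second-order systems and algebraic solvability -/

/-- `z` solves the system `z̈ = F(z, ż)` on the open set `J` of times, with `(z, ż)` staying in
the domain `D` of the system. -/
def IsSolutionOn {N : ℕ} (D : Set ((Fin N → ℂ) × (Fin N → ℂ)))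
    (F : (Fin N → ℂ) → (Fin N → ℂ) → (Fin N → ℂ)) (J : Set ℝ) (z : ℝ → Fin N → ℂ) : Prop :=
  ∀ t ∈ J, (z t, deriv z t) ∈ D ∧ DifferentiableAt ℝ z t ∧ DifferentiableAt ℝ (deriv z) t ∧
    deriv (deriv z) t = F (z t) (deriv z t)

/-- A solution of `z̈ = F(z, ż)` on an open interval `J`, with an initial time `t₀ ∈ J`. -/
structure Trajectory {N : ℕ} (D : Set ((Fin N → ℂ) × (Fin N → ℂ)))
    (F : (Fin N → ℂ) → (Fin N → ℂ) → (Fin N → ℂ)) where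
  /-- the interval of times -/
  J : Set ℝ
  /-- the initial time -/
  t₀ : ℝ
  /-- the solution -/
  z : ℝ → Fin N → ℂ
  isOpen : IsOpen J
  ordConnected : J.OrdConnected
  mem : t₀ ∈ J
  sol : IsSolutionOn D F J z

/-- The functions of (`i`, time), with time in the interval `J i`, that are obtained by algebraic
operations from the functions in `B`: the smallest class that contains `B` and the complex
constants, and is closed under sums, products, reciprocals of nowhere vanishing functions, and
extraction of a root, continuous in time, of a monic polynomial with coefficients in the class. -/
inductive AlgObtainable {ι : Type*} (J : ι → Set ℝ) (B : Set (ι → ℝ → ℂ)) : (ι → ℝ → ℂ) → Prop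
  | base (g : ι → ℝ → ℂ) (hg : g ∈ B) : AlgObtainable J B g
  | const (c : ℂ) : AlgObtainable J B (fun _ _ => c)
  | add (g g' : ι → ℝ → ℂ) (hg : AlgObtainable J B g) (hg' : AlgObtainable J B g') :
      AlgObtainable J B (fun i t => g i t + g' i t)
  | mul (g g' : ι → ℝ → ℂ) (hg : AlgObtainable J B g) (hg' : AlgObtainable J B g') :
      AlgObtainable J B (fun i t => g i t * g' i t)
  | inv (g : ι → ℝ → ℂ) (hg : AlgObtainable J B g) (h0 : ∀ i, ∀ t ∈ J i, g i t ≠ 0) :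
      AlgObtainable J B (fun i t => (g i t)⁻¹)
  | root (d : ℕ) (c : Fin d → ι → ℝ → ℂ) (hc : ∀ k, AlgObtainable J B (c k)) (g : ι → ℝ → ℂ)
      (hcont : ∀ i, ContinuousOn (g i) (J i))
      (hroot : ∀ i, ∀ t ∈ J i, g i t ^ d + ∑ k : Fin d, c k i t * g i t ^ (k : ℕ) = 0) :
      AlgObtainable J B g

/-- The data from which solutions are to be obtained: the functions of time (and initial time) in
the given class `K`, and the initial positions and velocities. -/
def initialData {N : ℕ} (K : Set (ℝ → ℝ → ℂ)) (D : Set ((Fin N → ℂ) × (Fin N → ℂ)))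
    (F : (Fin N → ℂ) → (Fin N → ℂ) → (Fin N → ℂ)) : Set (Trajectory D F → ℝ → ℂ) :=
  {g | (∃ κ ∈ K, g = fun T t => κ T.t₀ t) ∨
       (∃ k : Fin N, g = fun T _ => T.z T.t₀ k) ∨
       (∃ k : Fin N, g = fun T _ => (deriv T.z T.t₀ : Fin N → ℂ) k)}

/-- The system `z̈ = F(z, ż)` on the domain `D` is algebraically solvable over the class `K` of
known functions of time: every initial value problem with initial data in `D` has a solution, the
solution is unique, and its components are obtained by algebraic operations, the same for all
initial data, from known functions of time and the initial data. -/
structure AlgebraicallySolvable {N : ℕ} (K : Set (ℝ → ℝ → ℂ))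
    (D : Set ((Fin N → ℂ) × (Fin N → ℂ)))
    (F : (Fin N → ℂ) → (Fin N → ℂ) → (Fin N → ℂ)) : Prop where
  exists_solution : ∀ (t₀ : ℝ) (z₀ z₁ : Fin N → ℂ), (z₀, z₁) ∈ D →
    ∃ T : Trajectory D F, T.t₀ = t₀ ∧ T.z t₀ = z₀ ∧ deriv T.z t₀ = z₁
  unique_solution : ∀ T T' : Trajectory D F, T.t₀ = T'.t₀ → T.z T.t₀ = T'.z T'.t₀ →
    deriv T.z T.t₀ = deriv T'.z T'.t₀ → Set.EqOn T.z T'.z (T.J ∩ T'.J)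
  algebraic : ∀ n : Fin N,
    AlgObtainable (fun T : Trajectory D F => T.J) (initialData K D F) (fun T t => T.z t n)

/-! ### The induced `N`-body problem -/

/-- The right-hand side of the `N`-body problem
`ẍ = h^{(2)}(x; ẋ; y^{(N)}; ẏ^{(N)}; f(y^{(N)}, ẏ^{(N)}))`, with `y^{(N)}` and `ẏ^{(N)}` expressed
through `x` and `ẋ`. -/
def nBodyField {N : ℕ} (m₁ : ℕ) (f : (Fin N → ℂ) → (Fin N → ℂ) → (Fin N → ℂ))
    (x xd : Fin N → ℂ) : Fin N → ℂ :=
  h m₁ x xd (vieta m₁ x) (vietaDot m₁ x xd) (f (vieta m₁ x) (vietaDot m₁ x xd))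

/-- The domain of the `N`-body problem: `x_1, …, x_N` are distinct and `(y^{(N)}, ẏ^{(N)})` lies
in the domain `U` of `f`. -/
def nBodyDomain {N : ℕ} (m₁ : ℕ) (U : Set ((Fin N → ℂ) × (Fin N → ℂ))) :
    Set ((Fin N → ℂ) × (Fin N → ℂ)) :=
  {p | Function.Injective p.1 ∧ (vieta m₁ p.1, vietaDot m₁ p.1 p.2) ∈ U}

end

end MultipleRoot

/-! Write ψ = (z - x_1)^{m₁} φ with φ = ∏(z - x_n). The recursion for β collects powers of v = (1 -
X)^{m₁} - 1, so the alternating sum in α is a geometric series for (1 + v)⁻¹. Hence α_{nm} is the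
Taylor coefficient of (1 - X)^{-m₁} of degree n - m, and γ_n is minus the one of degree n
(`alpha_eq`, `gamma_eq`). Reversing coefficients turns division of ψ by (z - x_1)^{m₁} into
multiplication by (1 - x_1 X)^{-m₁}. So the coefficients of φ are explicit in y_1, …, y_N and x_1
(`coeff_eq_alpha_gamma`).

For (a), ψ is differentiated twice in t, then m₁ times in z, and evaluated at z = x_1. The
z-derivatives kill exactly the terms with y_j, j > N, and what remains is linear in ẍ_1
(`hFirst_eq`). For n ≥ 2, φ is differentiated twice in t and evaluated at its simple zero x_n. The
coefficients of φ bring in ẍ_1, which the first step supplies (`hOther_eq`).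

For (b), let V send the zeros x to (y_1, …, y_N). Applying (a) to a curve with prescribed position,
velocity v and acceleration w shows that h sends D²V(v, v) + DV w back to w (`h_second_derivative`).
Thus DV is invertible wherever the x_n are distinct, and h is injective in ÿ. It follows that V maps
solutions of the N-body problem to solutions of the y-system. Conversely, local inverses of V lift
solutions, and they also give uniqueness by a connectedness argument. Finally, x_1 is a root of the
m₁-th z-derivative of ψ, which has degree N and involves only y_1, …, y_N. Then φ has algebraically
obtainable coefficients, and every x_n is a root of φ (`algObtainable_of_firstCoeffs`). -/

namespace MultipleRoot

/-! ### The coefficients as Taylor coefficients of `(1 - X)^{-m₁}` -/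

/-- The Taylor coefficients of `(1 - X)^{-m₁}`. -/
noncomputable def negBinom (m₁ d : ℕ) : ℤ :=
  PowerSeries.coeff d (PowerSeries.invOneSubPow ℤ m₁).val

theorem coeff_one_sub_X_pow (m₁ i : ℕ) :
    PowerSeries.coeff i ((1 - PowerSeries.X : PowerSeries ℤ) ^ m₁) = (-1) ^ i * (m₁.choose i : ℤ) := by
  have h : ((1 - PowerSeries.X : PowerSeries ℤ) ^ m₁)
      = PowerSeries.rescale (-1 : ℤ) (((1 + X : ℤ[X]) ^ m₁ : ℤ[X]) : PowerSeries ℤ) := by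
    simp [PowerSeries.rescale_X, sub_eq_add_neg]
  rw [h, PowerSeries.coeff_rescale, Polynomial.coeff_coe, Polynomial.coeff_one_add_X_pow]

theorem one_sub_X_pow_mul_inv (m₁ : ℕ) :
    (1 - PowerSeries.X : PowerSeries ℤ) ^ m₁ * (PowerSeries.invOneSubPow ℤ m₁).val = 1 := by
  rw [← PowerSeries.invOneSubPow_inv_eq_one_sub_pow]
  exact (PowerSeries.invOneSubPow ℤ m₁).inv_mul

theorem coeff_pow_of_X_dvd {v : PowerSeries ℤ} (hv : PowerSeries.X ∣ v) {k d : ℕ} (hd : d < k)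
    (w : PowerSeries ℤ) : PowerSeries.coeff d (v ^ k * w) = 0 :=
  (PowerSeries.X_pow_dvd_iff.mp ((pow_dvd_pow_of_dvd hv k).mul_right w)) d hd

theorem X_dvd_one_sub_X_pow_sub_one (m₁ : ℕ) :
    (PowerSeries.X : PowerSeries ℤ) ∣ (1 - PowerSeries.X) ^ m₁ - 1 := by
  rw [PowerSeries.X_dvd_iff]
  simp

/-- The recursion for β is, up to sign, the Cauchy product `v * v ^ (k + 1)`. -/
theorem beta_eq (m₁ n k m : ℕ) :
    beta m₁ n (k + 1) m = (-1) ^ (k + (n - m)) *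
      PowerSeries.coeff (n - m) (((1 - PowerSeries.X : PowerSeries ℤ) ^ m₁ - 1) ^ (k + 1)) := by
  have hX := X_dvd_one_sub_X_pow_sub_one m₁
  set v : PowerSeries ℤ := (1 - PowerSeries.X) ^ m₁ - 1 with hv
  have hcoeff : ∀ i, i ≠ 0 → PowerSeries.coeff i v = (-1) ^ i * (m₁.choose i : ℤ) := by
    intro i hi
    rw [hv, map_sub, coeff_one_sub_X_pow, PowerSeries.coeff_one, if_neg hi, sub_zero]
  have hcoeff0 : PowerSeries.coeff 0 v = 0 := by
    simpa using coeff_pow_of_X_dvd hX (k := 1) (d := 0) one_pos 1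
  induction k generalizing m with
  | zero =>
    by_cases h : m < n
    · have : n - m ≠ 0 := by omega
      simp only [beta, if_pos h, zero_add, pow_one, hcoeff _ this]
      rw [← mul_assoc, ← mul_pow]; simp
    · have : n - m = 0 := by omega
      simp only [beta, if_neg h, zero_add, pow_one, this, hcoeff0, mul_zero]
  | succ k ih =>
    simp only [beta]
    rw [pow_succ' v (k + 1), PowerSeries.coeff_mul, ← sum_neg_distrib, mul_sum]
    symm
    -- Since `v` has no constant term, a pair `(i, j)` contributes only if `1 ≤ i` and `k + 1 ≤ j`;
    -- these bounds are the summation limits in `beta`.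
    apply sum_bij_ne_zero (fun p _ _ => p.1 + m)
    · rintro ⟨i, j⟩ hp hne
      rw [HasAntidiagonal.mem_antidiagonal] at hp
      simp only at hp hne ⊢
      have hi : i ≠ 0 := by
        rintro rfl
        exact hne (by rw [hcoeff0]; ring)
      have hj : k + 1 ≤ j := by
        by_contra hlt
        have := coeff_pow_of_X_dvd hX (not_le.mp hlt) 1
        rw [mul_one] at this
        exact hne (by rw [this]; ring)
      rw [mem_Icc]; omega
    · rintro ⟨i, j⟩ hp _ ⟨i', j'⟩ hp' _ h
      rw [HasAntidiagonal.mem_antidiagonal] at hp hp'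
      simp only at hp hp' h
      ext <;> simp only <;> omega
    · intro b hb _
      rw [mem_Icc] at hb
      have hmem : (b - m, n - b) ∈ antidiagonal (n - m) := by
        rw [HasAntidiagonal.mem_antidiagonal]; simp only; omega
      refine ⟨(b - m, n - b), hmem, ?_, by simp only; omega⟩
      rename_i hne
      intro h0
      apply hne
      rw [ih]
      have h1 := hcoeff (b - m) (by omega)
      simp only at h0
      rw [h1] at h0
      rcases mul_eq_zero.mp h0 with h | h
      · exact absurd h (by simp)
      · rcases mul_eq_zero.mp h with h | h
        · have : (m₁.choose (b - m) : ℤ) = 0 := by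
            rcases mul_eq_zero.mp h with h | h
            · exact absurd h (by simp)
            · exact h
          rw [this]; ring
        · rw [h]; ring
    · rintro ⟨i, j⟩ hp hne
      rw [HasAntidiagonal.mem_antidiagonal] at hp
      simp only at hp hne ⊢
      have hi : i ≠ 0 := by
        rintro rfl
        exact hne (by rw [hcoeff0]; ring)
      rw [ih, hcoeff i hi, show i + m - m = i by omega, show n - (i + m) = j by omega,
        show n - m = i + j by omega]
      have : ((-1 : ℤ) ^ i) * (-1) ^ i = 1 := by rw [← mul_pow]; simp
      calc _ = ((-1 : ℤ) ^ i * (-1) ^ i) * (-(-1) ^ (k + j) * (m₁.choose i : ℤ)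
            * PowerSeries.coeff j (v ^ (k + 1))) := by ring
        _ = _ := by rw [this]; ring

theorem sum_neg_pow_mul {R : Type*} [CommRing R] (v : R) (d : ℕ) :
    (∑ k ∈ Icc 1 d, (-1) ^ k * v ^ k) * (1 + v) = -v + (-1) ^ d * v ^ (d + 1) := by
  induction d with
  | zero => simp
  | succ d ih =>
    rw [sum_Icc_succ_top (by omega), add_mul, ih]; ring

/-- The geometric series for `(1 + v)⁻¹` may be cut off at exponent `n - m`: the remainder is
divisible by `X ^ (n - m + 1)`. -/
theorem alpha_eq {m₁ n m : ℕ} (h : m < n) : alpha m₁ n m = negBinom m₁ (n - m) := by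
  set v : PowerSeries ℤ := (1 - PowerSeries.X) ^ m₁ - 1 with hv
  set A : PowerSeries ℤ := (PowerSeries.invOneSubPow ℤ m₁).val with hA
  have hvA : (1 + v) * A = 1 := by
    rw [hv, hA]; simpa using one_sub_X_pow_mul_inv m₁
  have hs := sum_neg_pow_mul v (n - m)
  have hG : ∑ k ∈ Icc 1 (n - m), (-1) ^ k * v ^ k
      = A - 1 + (-1) ^ (n - m) * (v ^ (n - m + 1) * A) := by
    calc _ = (∑ k ∈ Icc 1 (n - m), (-1) ^ k * v ^ k) * ((1 + v) * A) := by rw [hvA, mul_one]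
      _ = _ := by
        rw [← mul_assoc, hs]
        have : v * A = 1 - A := by rw [← hvA]; ring
        linear_combination -this
  have hG' := congrArg (PowerSeries.coeff (n - m)) hG
  have hz : PowerSeries.coeff (n - m) ((-1) ^ (n - m) * (v ^ (n - m + 1) * A)) = 0 := by
    rw [show (-1 : PowerSeries ℤ) ^ (n - m) * (v ^ (n - m + 1) * A)
      = v ^ (n - m + 1) * ((-1) ^ (n - m) * A) by ring]
    exact coeff_pow_of_X_dvd (X_dvd_one_sub_X_pow_sub_one m₁) (Nat.lt_succ_self _) _
  rw [map_add, hz, add_zero, map_sub, PowerSeries.coeff_one, if_neg (by omega), sub_zero,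
    map_sum] at hG'
  rw [negBinom, ← hA, ← hG', alpha, mul_sum]
  refine sum_congr rfl fun k hk => ?_
  obtain ⟨k, rfl⟩ : ∃ l, k = l + 1 := ⟨k - 1, by rw [mem_Icc] at hk; omega⟩
  rw [beta_eq, ← hv]
  have e : ((-1 : PowerSeries ℤ) ^ (k + 1) * v ^ (k + 1))
      = PowerSeries.C ((-1 : ℤ) ^ (k + 1)) * v ^ (k + 1) := by simp
  rw [e, PowerSeries.coeff_C_mul, ← mul_assoc, ← pow_add]
  congr 1
  rw [show n + m + 1 + (k + (n - m)) = (k + 1) + 2 * n by omega, pow_add, pow_mul]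
  simp

theorem sum_choose_mul_negBinom (m₁ : ℕ) {n : ℕ} (hn : n ≠ 0) :
    ∑ j ∈ range (n + 1), (-1) ^ j * (m₁.choose j : ℤ) * negBinom m₁ (n - j) = 0 := by
  have := congrArg (PowerSeries.coeff n) (one_sub_X_pow_mul_inv m₁)
  rw [PowerSeries.coeff_mul, PowerSeries.coeff_one, if_neg hn,
    Nat.sum_antidiagonal_eq_sum_range_succ_mk] at this
  rw [← this]
  exact sum_congr rfl fun j _ => by rw [coeff_one_sub_X_pow]; rfl

theorem negBinom_zero (m₁ : ℕ) : negBinom m₁ 0 = 1 := by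
  have := congrArg (PowerSeries.coeff 0) (one_sub_X_pow_mul_inv m₁)
  rw [PowerSeries.coeff_mul] at this
  simpa [negBinom] using this

theorem range_succ_eq (n : ℕ) :
    range (n + 1) = insert 0 (insert n (Icc 1 (n - 1))) := by
  ext j; simp only [mem_range, mem_insert, mem_Icc]; omega

theorem sum_range_succ_eq {M : Type*} [AddCommMonoid M] {n : ℕ} (hn : n ≠ 0) (g : ℕ → M) :
    ∑ j ∈ range (n + 1), g j = g 0 + (g n + ∑ j ∈ Icc 1 (n - 1), g j) := by
  rw [range_succ_eq n, sum_insert, sum_insert]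
  · simp only [mem_Icc]; omega
  · simp only [mem_insert, mem_Icc]; omega

/-- In degree `n`, the product of `(1 - X) ^ m₁` and its inverse is a vanishing convolution; γ_n is
this convolution without its `j = 0` term. -/
theorem gamma_eq {m₁ n : ℕ} (hn : n ≠ 0) : gamma m₁ n = -negBinom m₁ n := by
  have h := sum_choose_mul_negBinom m₁ hn
  rw [sum_range_succ_eq hn] at h
  have e : ∑ j ∈ Icc 1 (n - 1), (-1) ^ j * (m₁.choose j : ℤ) * alpha m₁ n j
      = ∑ j ∈ Icc 1 (n - 1), (-1) ^ j * (m₁.choose j : ℤ) * negBinom m₁ (n - j) :=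
    sum_congr rfl fun j hj => by rw [alpha_eq (by rw [mem_Icc] at hj; omega)]
  rw [gamma, e]
  simp only [Nat.sub_self, negBinom_zero, pow_zero, Nat.choose_zero_right, Nat.sub_zero,
    Nat.cast_one, one_mul, mul_one] at h
  linarith

/-! ### Division of a polynomial by `(X - a)^{m₁}` -/

theorem reflect_X_sub_C_pow (a : ℂ) (m₁ : ℕ) :
    reflect m₁ ((X - C a) ^ m₁) = (1 - C a * X) ^ m₁ := by
  induction m₁ with
  | zero => simp [← C_1, -map_one, reflect_C]
  | succ k ih =>
    rw [pow_succ, reflect_mul _ _ (F := k) (G := 1), ih, pow_succ]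
    · congr 1
      rw [reflect_sub, reflect_C, reflect_one_X, pow_one]
    · exact natDegree_pow_le_of_le k (natDegree_X_sub_C_le a) |>.trans (by simp)
    · exact natDegree_X_sub_C_le a

/-- Reflection turns the factor `(X - C a) ^ m₁` into `(1 - C a * X) ^ m₁`, which is invertible as a
power series. Low degrees of the reflected product are its top coefficients, so the lower ones never
enter. -/
theorem coeff_of_mul_X_sub_C_pow {N : ℕ} (m₁ : ℕ) (a : ℂ) (φ : ℂ[X]) (hφ : φ.natDegree ≤ N)
    {m : ℕ} (hm : m ≤ N) :
    φ.coeff (N - m) = ∑ j ∈ range (m + 1),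
      (negBinom m₁ (m - j) : ℂ) * a ^ (m - j) * ((X - C a) ^ m₁ * φ).coeff (N + m₁ - j) := by
  have hr : reflect (m₁ + N) ((X - C a) ^ m₁ * φ) = (1 - C a * X) ^ m₁ * reflect N φ := by
    rw [reflect_mul _ _ _ hφ, reflect_X_sub_C_pow]
    exact natDegree_pow_le_of_le m₁ (natDegree_X_sub_C_le a) |>.trans (by simp)
  set B : PowerSeries ℂ := PowerSeries.rescale a
    (PowerSeries.map (Int.castRingHom ℂ) (PowerSeries.invOneSubPow ℤ m₁).val) with hB
  have hB1 : B * (1 - PowerSeries.C a * PowerSeries.X) ^ m₁ = 1 := by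
    have := congrArg (fun p => PowerSeries.rescale a (PowerSeries.map (Int.castRingHom ℂ) p))
      (one_sub_X_pow_mul_inv m₁)
    simp only [map_mul, map_pow, map_sub, map_one, PowerSeries.map_X, PowerSeries.rescale_X]
      at this
    rw [mul_comm]; exact this
  have hp : (reflect N φ : PowerSeries ℂ)
      = (reflect (m₁ + N) ((X - C a) ^ m₁ * φ) : PowerSeries ℂ) * B := by
    rw [hr]
    push_cast
    rw [mul_right_comm, mul_comm _ B]
    rw [hB1, one_mul]
  have := congrArg (PowerSeries.coeff m) hp
  rw [PowerSeries.coeff_mul, Polynomial.coeff_coe, coeff_reflect, revAt_le hm,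
    Nat.sum_antidiagonal_eq_sum_range_succ_mk] at this
  rw [this]
  refine sum_congr rfl fun j hj => ?_
  rw [mem_range] at hj
  simp only
  rw [Polynomial.coeff_coe, coeff_reflect, revAt_le (by omega), hB, PowerSeries.coeff_rescale,
    PowerSeries.coeff_map, add_comm m₁ N]
  simp only [negBinom, eq_intCast]
  ring

/-- The coefficients of a monic `φ` through those of `(X - a)^{m₁} φ`. -/
theorem coeff_eq_alpha_gamma {N : ℕ} (m₁ : ℕ) (a : ℂ) (φ : ℂ[X]) (hφ : φ.natDegree = N)
    (hmon : φ.Monic) {m : ℕ} (hm1 : 1 ≤ m) (hm : m ≤ N) :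
    φ.coeff (N - m) = ((X - C a) ^ m₁ * φ).coeff (N + m₁ - m)
      + ∑ j ∈ Icc 1 (m - 1), (alpha m₁ m j : ℂ) * a ^ (m - j)
          * ((X - C a) ^ m₁ * φ).coeff (N + m₁ - j)
      - (gamma m₁ m : ℂ) * a ^ m := by
  have hlead : ((X - C a) ^ m₁ * φ).coeff (N + m₁) = 1 := by
    have h1 : ((X - C a) ^ m₁ * φ).Monic := ((monic_X_sub_C a).pow m₁).mul hmon
    have h2 : ((X - C a) ^ m₁ * φ).natDegree = N + m₁ := by
      rw [((monic_X_sub_C a).pow m₁).natDegree_mul hmon, hφ, (monic_X_sub_C a).natDegree_pow]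
      simp [add_comm]
    rw [← h2]; exact h1
  rw [coeff_of_mul_X_sub_C_pow m₁ a φ hφ.le hm, sum_range_succ_eq (by omega), gamma_eq (by omega)]
  have e : ∑ j ∈ Icc 1 (m - 1), (alpha m₁ m j : ℂ) * a ^ (m - j)
          * ((X - C a) ^ m₁ * φ).coeff (N + m₁ - j)
      = ∑ j ∈ Icc 1 (m - 1), (negBinom m₁ (m - j) : ℂ) * a ^ (m - j)
          * ((X - C a) ^ m₁ * φ).coeff (N + m₁ - j) :=
    sum_congr rfl fun j hj => by rw [alpha_eq (by rw [mem_Icc] at hj; omega)]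
  rw [e, Nat.sub_self, negBinom_zero, Nat.sub_zero, Nat.sub_zero, hlead]
  push_cast
  ring

open Filter Topology

/-! ### Second-order jets -/

/-- This identity and the next are the inductive steps of the power rule. Where an exponent is
truncated at 0, the factor `k` or `k * (k - 1)` vanishes. -/
theorem jet_pow_succ_fst {R : Type*} [CommRing R] (a b : R) (k : ℕ) :
    ((k + 1 : ℕ) : R) * a ^ (k + 1 - 1) * b = k * a ^ (k - 1) * b * a + a ^ k * b := by
  rcases k with _ | k
  · simp
  · simp only [Nat.add_sub_cancel]
    push_cast
    ring

theorem jet_pow_succ_snd {R : Type*} [CommRing R] (a b c : R) (k : ℕ) :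
    ((k + 1 : ℕ) : R) * ((k + 1 : ℕ) - 1) * a ^ (k + 1 - 2) * b ^ 2
        + ((k + 1 : ℕ) : R) * a ^ (k + 1 - 1) * c
      = (k * (k - 1) * a ^ (k - 2) * b ^ 2 + k * a ^ (k - 1) * c) * a
        + 2 * (k * a ^ (k - 1) * b) * b + a ^ k * c := by
  rcases k with _ | _ | k
  · simp
  · simp
    ring
  · simp only [Nat.add_sub_cancel, show k + 1 + 1 + 1 - 2 = k + 1 by omega,
      show k + 1 + 1 - 2 = k by omega]
    push_cast
    ring

/-- `f` is differentiable near `t` and has the value `a`, the first derivative `b` and the second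
derivative `c` at `t`. -/
def HasJet (f : ℝ → ℂ) (t : ℝ) (a b c : ℂ) : Prop :=
  f t = a ∧ (∀ᶠ s in 𝓝 t, DifferentiableAt ℝ f s) ∧ deriv f t = b ∧ HasDerivAt (deriv f) c t

namespace HasJet

variable {f g : ℝ → ℂ} {t : ℝ} {a b c a' b' c' : ℂ}

theorem of_eventually (f' : ℝ → ℂ) (h0 : f t = a) (h1 : ∀ᶠ s in 𝓝 t, HasDerivAt f (f' s) s)
    (h2 : f' t = b) (h3 : HasDerivAt f' c t) : HasJet f t a b c := by
  have e : deriv f =ᶠ[𝓝 t] f' := h1.mono fun s hs => hs.deriv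
  exact ⟨h0, h1.mono fun s hs => hs.differentiableAt, e.eq_of_nhds.trans h2,
    h3.congr_of_eventuallyEq e⟩

theorem eventually (hf : HasJet f t a b c) : ∀ᶠ s in 𝓝 t, HasDerivAt f (deriv f s) s :=
  hf.2.1.mono fun _ hs => hs.hasDerivAt

theorem unique (hf : HasJet f t a b c) (hf' : HasJet f t a' b' c') : b = b' ∧ c = c' :=
  ⟨hf.2.2.1.symm.trans hf'.2.2.1, hf.2.2.2.unique hf'.2.2.2⟩

theorem congr (hf : HasJet f t a b c) (h : g =ᶠ[𝓝 t] f) : HasJet g t a b c := by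
  refine of_eventually (deriv f) (h.eq_of_nhds.trans hf.1) ?_ hf.2.2.1 hf.2.2.2
  filter_upwards [hf.eventually, h.eventually_nhds] with s hs h's
  exact hs.congr_of_eventuallyEq h's

theorem const (a : ℂ) (t : ℝ) : HasJet (fun _ => a) t a 0 0 :=
  of_eventually (fun _ => 0) rfl (Eventually.of_forall fun s => hasDerivAt_const s a) rfl
    (hasDerivAt_const t 0)

theorem add (hf : HasJet f t a b c) (hg : HasJet g t a' b' c') :
    HasJet (fun s => f s + g s) t (a + a') (b + b') (c + c') := by
  refine of_eventually (fun s => deriv f s + deriv g s) (by rw [hf.1, hg.1]) ?_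
    (by rw [hf.2.2.1, hg.2.2.1]) (hf.2.2.2.add hg.2.2.2)
  filter_upwards [hf.eventually, hg.eventually] with s h1 h2 using h1.add h2

theorem mul (hf : HasJet f t a b c) (hg : HasJet g t a' b' c') :
    HasJet (fun s => f s * g s) t (a * a') (b * a' + a * b') (c * a' + 2 * b * b' + a * c') := by
  refine of_eventually (fun s => deriv f s * g s + f s * deriv g s) (by rw [hf.1, hg.1]) ?_
    (by rw [hf.2.2.1, hg.2.2.1, hf.1, hg.1]) ?_
  · filter_upwards [hf.eventually, hg.eventually] with s h1 h2 using h1.mul h2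
  · have h := (hf.2.2.2.mul hg.eventually.self_of_nhds).add
      (hf.eventually.self_of_nhds.mul hg.2.2.2)
    rw [hf.2.2.1, hg.2.2.1, hf.1, hg.1] at h
    exact h.congr_deriv (by ring)

theorem const_mul (k : ℂ) (hf : HasJet f t a b c) :
    HasJet (fun s => k * f s) t (k * a) (k * b) (k * c) := by
  convert (const k t).mul hf using 1 <;> ring

theorem sub (hf : HasJet f t a b c) (hg : HasJet g t a' b' c') :
    HasJet (fun s => f s - g s) t (a - a') (b - b') (c - c') := by
  convert hf.add (hg.const_mul (-1)) using 1
  · ext s; ring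
  all_goals ring

theorem sum {ι : Type*} (S : Finset ι) {f : ι → ℝ → ℂ} {a b c : ι → ℂ}
    (h : ∀ i ∈ S, HasJet (f i) t (a i) (b i) (c i)) :
    HasJet (fun s => ∑ i ∈ S, f i s) t (∑ i ∈ S, a i) (∑ i ∈ S, b i) (∑ i ∈ S, c i) := by
  classical
  induction S using Finset.induction_on with
  | empty => simpa using const 0 t
  | insert i S hi ih =>
    simp only [sum_insert hi]
    exact (h i (mem_insert_self _ _)).add (ih fun j hj => h j (mem_insert_of_mem hj))

theorem pow (hf : HasJet f t a b c) (k : ℕ) :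
    HasJet (fun s => f s ^ k) t (a ^ k) (k * a ^ (k - 1) * b)
      (k * (k - 1) * a ^ (k - 2) * b ^ 2 + k * a ^ (k - 1) * c) := by
  induction k with
  | zero => simpa using const 1 t
  | succ k ih =>
    have h := ih.mul hf
    rw [← jet_pow_succ_fst, ← jet_pow_succ_snd] at h
    simpa only [pow_succ] using h

end HasJet

/-- The coefficients of the polynomial-valued function `p` have the jets given by the coefficients
of `a`, `b`, `c`. -/
def HasPolyJet (p : ℝ → ℂ[X]) (t : ℝ) (a b c : ℂ[X]) : Prop :=
  ∀ k, HasJet (fun s => (p s).coeff k) t (a.coeff k) (b.coeff k) (c.coeff k)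

namespace HasPolyJet

variable {p q : ℝ → ℂ[X]} {t : ℝ} {a b c a' b' c' : ℂ[X]}

theorem const (a : ℂ[X]) (t : ℝ) : HasPolyJet (fun _ => a) t a 0 0 := fun k => by
  simpa using HasJet.const (a.coeff k) t

theorem mul (hp : HasPolyJet p t a b c) (hq : HasPolyJet q t a' b' c') :
    HasPolyJet (fun s => p s * q s) t (a * a') (b * a' + a * b')
      (c * a' + 2 * b * b' + a * c') := fun k => by
  have h := HasJet.sum (antidiagonal k) fun i _ => (hp i.1).mul (hq i.2)
  have e : (2 * b * b').coeff k = ∑ i ∈ antidiagonal k, 2 * b.coeff i.1 * b'.coeff i.2 := by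
    rw [mul_assoc, ← C_ofNat, coeff_C_mul, coeff_mul, mul_sum]
    exact sum_congr rfl fun _ _ => by rw [mul_assoc]
  simpa only [coeff_add, e, coeff_mul, sum_add_distrib] using h

theorem X_sub_C {x : ℝ → ℂ} {x₀ x₁ x₂ : ℂ} (hx : HasJet x t x₀ x₁ x₂) :
    HasPolyJet (fun s => X - C (x s)) t (X - C x₀) (-C x₁) (-C x₂) := fun k => by
  rcases k with _ | k
  · simpa using hx.const_mul (-1)
  · simpa [coeff_X, coeff_C] using HasJet.const (if k = 0 then 1 else 0) t

theorem pow (hp : HasPolyJet p t a b c) (k : ℕ) :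
    HasPolyJet (fun s => p s ^ k) t (a ^ k) (k * a ^ (k - 1) * b)
      (k * (k - 1) * a ^ (k - 2) * b ^ 2 + k * a ^ (k - 1) * c) := by
  induction k with
  | zero => simpa using const 1 t
  | succ k ih =>
    have h := ih.mul hp
    rw [← jet_pow_succ_fst, ← jet_pow_succ_snd] at h
    simpa only [pow_succ] using h

/-- The second derivative is left unspecified: later it is always multiplied by a power of `X - C a`
that removes it on evaluation. -/
theorem prod_X_sub_C {x : ℕ → ℝ → ℂ} {x₀ x₁ x₂ : ℕ → ℂ} (S : Finset ℕ)
    (hx : ∀ k ∈ S, HasJet (x k) t (x₀ k) (x₁ k) (x₂ k)) :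
    ∃ P, HasPolyJet (fun s => ∏ k ∈ S, (X - C (x k s))) t (∏ k ∈ S, (X - C (x₀ k)))
      (-∑ k ∈ S, C (x₁ k) * ∏ l ∈ S.erase k, (X - C (x₀ l))) P := by
  induction S using Finset.induction_on with
  | empty => exact ⟨0, by simpa using const 1 t⟩
  | insert i S hi ih =>
    obtain ⟨P, hP⟩ := ih fun k hk => hx k (mem_insert_of_mem hk)
    have h := (X_sub_C (hx i (mem_insert_self _ _))).mul hP
    simp only [prod_insert hi]
    have e : -∑ k ∈ insert i S, C (x₁ k) * ∏ l ∈ (insert i S).erase k, (X - C (x₀ l))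
        = -C (x₁ i) * ∏ k ∈ S, (X - C (x₀ k))
          + (X - C (x₀ i)) * -∑ k ∈ S, C (x₁ k) * ∏ l ∈ S.erase k, (X - C (x₀ l)) := by
      rw [sum_insert hi, erase_insert hi, neg_add, mul_neg, mul_sum, neg_mul]
      congr 2
      refine sum_congr rfl fun k hk => ?_
      have hki : i ≠ k := fun h => hi (h ▸ hk)
      rw [erase_insert_of_ne hki, prod_insert fun h => hi (mem_of_mem_erase h)]
      ring
    exact ⟨_, e ▸ h⟩

/-- The leading coefficient is constantly 1, so its time derivatives vanish. -/
theorem natDegree_lt {M : ℕ} (hM : 0 < M) (hp : HasPolyJet p t a b c)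
    (h : ∀ᶠ s in 𝓝 t, (p s).Monic ∧ (p s).natDegree = M) : c.natDegree < M := by
  suffices hle : c.natDegree ≤ M - 1 by omega
  refine natDegree_le_iff_coeff_eq_zero.mpr fun k hk => ?_
  have hc : (fun s => (p s).coeff k) =ᶠ[𝓝 t] fun _ => if k = M then 1 else 0 := by
    filter_upwards [h] with s hs
    split_ifs with hkM
    · rw [hkM, ← hs.2]; exact hs.1
    · exact coeff_eq_zero_of_natDegree_lt (by omega)
  exact ((hp k).unique ((HasJet.const _ t).congr hc)).2

end HasPolyJet

/-! ### The second derivatives of the zeros, in terms of jets -/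

theorem hasseDeriv_eval_eq_sum {M : ℕ} (m : ℕ) {p : ℂ[X]} (hp : p.natDegree < M + m) (hM : 0 < M)
    (z : ℂ) : (hasseDeriv m p).eval z
      = ∑ i ∈ range M, ((i + m).choose m : ℂ) * p.coeff (i + m) * z ^ i := by
  have hd : (hasseDeriv m p).natDegree < M :=
    (natDegree_hasseDeriv_le p m).trans_lt (by omega)
  rw [eval_eq_sum_range' hd]
  exact sum_congr rfl fun i _ => by rw [hasseDeriv_coeff]

theorem sum_range_eq_sum_Icc {M : Type*} [AddCommMonoid M] (N : ℕ) (g : ℕ → M) :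
    ∑ i ∈ range N, g i = ∑ j ∈ Icc 1 N, g (N - j) := by
  refine sum_bij' (fun i _ => N - i) (fun j _ => N - j) ?_ ?_ ?_ ?_ ?_
  · intro i hi; rw [mem_range] at hi; rw [mem_Icc]; omega
  · intro j hj; rw [mem_Icc] at hj; rw [mem_range]; omega
  · intro i hi; rw [mem_range] at hi; omega
  · intro j hj; rw [mem_Icc] at hj; omega
  · intro i hi
    rw [mem_range] at hi
    rw [show N - (N - i) = i by omega]

theorem prod_erase_eq {S : Finset ℕ} {u : ℕ → ℂ} {k : ℕ} (hk : k ∈ S) (hu : u k ≠ 0) :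
    ∏ l ∈ S.erase k, u l = (∏ l ∈ S, u l) * (u k)⁻¹ := by
  rw [← mul_prod_erase S u hk]
  field_simp

theorem eval_jet_prod {S : Finset ℕ} (x₀ x₁ : ℕ → ℂ) (z : ℂ) (hz : ∀ k ∈ S, z - x₀ k ≠ 0) :
    (-∑ k ∈ S, C (x₁ k) * ∏ l ∈ S.erase k, (X - C (x₀ l))).eval z
      = -((∏ l ∈ S, (z - x₀ l)) * ∑ k ∈ S, x₁ k / (z - x₀ k)) := by
  rw [eval_neg, eval_finsetSum, mul_sum]
  congr 1
  refine sum_congr rfl fun k hk => ?_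
  simp only [eval_mul, eval_C, eval_prod, eval_sub, eval_X]
  rw [prod_erase_eq (u := fun l => z - x₀ l) hk (hz k hk)]
  ring

theorem eval_derivative_prod {S : Finset ℕ} (x₀ : ℕ → ℂ) (z : ℂ) (hz : ∀ k ∈ S, z - x₀ k ≠ 0) :
    (derivative (∏ k ∈ S, (X - C (x₀ k)))).eval z
      = (∏ l ∈ S, (z - x₀ l)) * ∑ k ∈ S, 1 / (z - x₀ k) := by
  rw [derivative_prod_finset, eval_finsetSum, mul_sum]
  refine sum_congr rfl fun k hk => ?_
  simp only [derivative_sub, derivative_X, derivative_C, sub_zero, mul_one, eval_prod, eval_sub,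
    eval_X, eval_C]
  rw [prod_erase_eq (u := fun l => z - x₀ l) hk (hz k hk)]
  ring

/-- The argument of `hasseDeriv` is the second time derivative of `(z - x_1) ^ (m + 1) * P`. After
translating `a` to 0, its coefficient of degree `m` sees `P` to first order, `P₁` to order zero and
`P₂` not at all. -/
theorem coeff_taylor_jet (m : ℕ) (hm : 1 ≤ m) (a b c : ℂ) (P P₁ P₂ : ℂ[X]) :
    (hasseDeriv m (((m + 1 : ℕ) : ℂ[X]) * (((m + 1 : ℕ) : ℂ[X]) - 1)
          * (X - C a) ^ (m + 1 - 2) * (-C b) ^ 2 * P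
        + ((m + 1 : ℕ) : ℂ[X]) * (X - C a) ^ (m + 1 - 1) * (-C c) * P
        + 2 * (((m + 1 : ℕ) : ℂ[X]) * (X - C a) ^ (m + 1 - 1) * (-C b)) * P₁
        + (X - C a) ^ (m + 1) * P₂)).eval a
      = (m + 1) * m * b ^ 2 * (derivative P).eval a - (m + 1) * c * P.eval a
        - 2 * (m + 1) * b * P₁.eval a := by
  obtain ⟨m, rfl⟩ : ∃ l, m = l + 1 := ⟨m - 1, by omega⟩
  have key : ∀ Q : ℂ[X], (taylor a Q).coeff 0 = Q.eval a := fun Q => taylor_coeff_zero a Q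
  have key1 : ∀ Q : ℂ[X], (taylor a Q).coeff 1 = (derivative Q).eval a :=
    fun Q => taylor_coeff_one a Q
  rw [← taylor_coeff]
  have e : ∀ Q : ℂ[X], taylor a Q = taylorAlgHom a Q := fun _ => rfl
  have hX : taylorAlgHom a (X - C a) = X := by
    rw [← e, map_sub, taylor_X, taylor_C]; simp
  have hC : ∀ z, taylorAlgHom a (C z) = C z := fun z => by rw [← e, taylor_C]
  rw [e]
  simp only [map_add, map_mul, map_pow, map_neg, map_sub, map_one, map_natCast, map_ofNat, hX, hC]
  simp only [← e, show m + 1 + 1 - 2 = m by omega, Nat.add_sub_cancel]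
  have r1 : ((m + 1 + 1 : ℕ) : ℂ[X]) * (((m + 1 + 1 : ℕ) : ℂ[X]) - 1) * X ^ m * (-C b) ^ 2
      * taylor a P = C (((m : ℂ) + 2) * (m + 1) * b ^ 2) * (taylor a P * X ^ m) := by
    simp only [map_mul, map_add, map_pow, map_natCast, map_one, map_ofNat]; push_cast; ring
  have r2 : ((m + 1 + 1 : ℕ) : ℂ[X]) * X ^ (m + 1) * (-C c) * taylor a P
      = C (-((m : ℂ) + 2) * c) * (taylor a P * X ^ (m + 1)) := by
    simp only [map_mul, map_add, map_neg, map_natCast, map_ofNat]; push_cast; ring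
  have r3 : 2 * (((m + 1 + 1 : ℕ) : ℂ[X]) * X ^ (m + 1) * (-C b)) * taylor a P₁
      = C (-2 * ((m : ℂ) + 2) * b) * (taylor a P₁ * X ^ (m + 1)) := by
    simp only [map_mul, map_add, map_neg, map_natCast, map_ofNat]; push_cast; ring
  rw [r1, r2, r3, mul_comm (X ^ (m + 1 + 1))]
  simp only [coeff_add, coeff_C_mul]
  have c1 : (taylor a P * X ^ m).coeff (m + 1) = (derivative P).eval a := by
    rw [← key1, add_comm m 1, coeff_mul_X_pow]
  have c2 : ∀ Q : ℂ[X], (taylor a Q * X ^ (m + 1)).coeff (m + 1) = Q.eval a := fun Q => by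
    rw [← key, ← zero_add (m + 1), zero_add (m + 1)]
    simpa using coeff_mul_X_pow (taylor a Q) (m + 1) 0
  have c3 : (taylor a P₂ * X ^ (m + 1 + 1)).coeff (m + 1) = 0 := by
    rw [coeff_mul_X_pow', if_neg (by omega)]
  rw [c1, c2, c2, c3]
  push_cast
  ring

/-- The factor (N - j + 1)_{m₁} comes from differentiating z^{N + m₁ - j} `m₁` times; coefficients
of degree below `m₁` disappear. -/
theorem pochSum_eq {N m₁ : ℕ} (hN : 0 < N) {p : ℂ[X]} (hp : p.natDegree < N + m₁) (x w : ℕ → ℂ)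
    (hw : ∀ j ∈ Icc 1 N, w j = p.coeff (N + m₁ - j)) :
    pochSum N m₁ x w = m₁.factorial * (hasseDeriv m₁ p).eval (x 1) := by
  rw [hasseDeriv_eval_eq_sum m₁ hp hN, sum_range_eq_sum_Icc, pochSum, mul_sum]
  refine sum_congr rfl fun j hj => ?_
  rw [hw j hj, Nat.ascFactorial_eq_factorial_mul_choose]
  rw [mem_Icc] at hj
  rw [show N - j + m₁ = N + m₁ - j by omega]
  push_cast
  ring

theorem natDegree_prod_X_sub_C {S : Finset ℕ} (x : ℕ → ℂ) :
    (∏ k ∈ S, (X - C (x k))).natDegree = S.card := by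
  rw [natDegree_prod_of_monic _ _ fun k _ => monic_X_sub_C _]
  simp

theorem monic_prod_X_sub_C {S : Finset ℕ} (x : ℕ → ℂ) : (∏ k ∈ S, (X - C (x k))).Monic :=
  monic_prod_of_monic _ _ fun _ _ => monic_X_sub_C _

theorem monic_natDegree_pow_mul {N : ℕ} (m₁ : ℕ) (x : ℕ → ℂ) :
    ((X - C (x 1)) ^ m₁ * ∏ k ∈ Icc 1 N, (X - C (x k))).Monic ∧
    ((X - C (x 1)) ^ m₁ * ∏ k ∈ Icc 1 N, (X - C (x k))).natDegree = N + m₁ := by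
  have h1 := (monic_X_sub_C (x 1)).pow m₁
  refine ⟨h1.mul (monic_prod_X_sub_C x), ?_⟩
  rw [h1.natDegree_mul (monic_prod_X_sub_C x), natDegree_prod_X_sub_C,
    (monic_X_sub_C _).natDegree_pow]
  simp [add_comm]

theorem pow_mul_prod_Icc {N : ℕ} (hN : 1 ≤ N) (m₁ : ℕ) (x : ℕ → ℂ) :
    (X - C (x 1)) ^ m₁ * ∏ k ∈ Icc 1 N, (X - C (x k))
      = (X - C (x 1)) ^ (m₁ + 1) * ∏ k ∈ Icc 2 N, (X - C (x k)) := by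
  rw [← mul_prod_Ioc_eq_prod_Icc hN, pow_succ, mul_assoc]
  rfl

section

variable {N m₁ : ℕ} {x y : ℕ → ℝ → ℂ} {t : ℝ} {x₀ x₁ x₂ y₀ y₁ y₂ : ℕ → ℂ}

/-- The `m₁`-th Hasse derivative of ψ_tt at x_1 is computed twice: from the ÿ_j, and from ψ = (z -
x_1)^{m₁ + 1} P. Solving for ẍ_1 requires P(x_1) ≠ 0, that is, distinct zeros. -/
theorem hFirst_eq (hN : 1 ≤ N) (hm : 1 ≤ m₁)
    (hx : ∀ k ∈ Icc 1 N, HasJet (x k) t (x₀ k) (x₁ k) (x₂ k))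
    (hinj : Set.InjOn x₀ (Icc 1 N : Finset ℕ))
    (hy : ∀ j ∈ Icc 1 N, HasJet (y j) t (y₀ j) (y₁ j) (y₂ j))
    (hxy : ∀ j ∈ Icc 1 N, ∀ᶠ s in 𝓝 t, y j s
      = ((X - C (x 1 s)) ^ m₁ * ∏ k ∈ Icc 1 N, (X - C (x k s))).coeff (N + m₁ - j)) :
    hFirst N m₁ x₀ x₁ y₂ = x₂ 1 := by
  have hsub : ∀ k ∈ Icc 2 N, k ∈ Icc 1 N := fun k hk => by rw [mem_Icc] at hk ⊢; omega
  have h1mem : 1 ∈ Icc 1 N := by rw [mem_Icc]; omega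
  have hz : ∀ k ∈ Icc 2 N, x₀ 1 - x₀ k ≠ 0 := fun k hk h => by
    have := hinj (mem_coe.mpr h1mem) (mem_coe.mpr (hsub k hk)) (sub_eq_zero.mp h)
    rw [mem_Icc] at hk; omega
  obtain ⟨P₂, hP⟩ := HasPolyJet.prod_X_sub_C (Icc 2 N) fun k hk => hx k (hsub k hk)
  have hψ := ((HasPolyJet.X_sub_C (hx 1 h1mem)).pow (m₁ + 1)).mul hP
  have hψe : (fun s => (X - C (x 1 s)) ^ (m₁ + 1) * ∏ k ∈ Icc 2 N, (X - C (x k s)))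
      = fun s => (X - C (x 1 s)) ^ m₁ * ∏ k ∈ Icc 1 N, (X - C (x k s)) :=
    funext fun s => (pow_mul_prod_Icc hN m₁ fun k => x k s).symm
  rw [hψe] at hψ
  have hdeg := hψ.natDegree_lt (M := N + m₁) (by omega)
    (Eventually.of_forall fun s => monic_natDegree_pow_mul m₁ fun k => x k s)
  have hpoch := pochSum_eq (by omega) hdeg x₀ y₂ fun j hj =>
    ((hy j hj).unique ((hψ _).congr (hxy j hj))).2
  rw [add_mul] at hpoch
  rw [coeff_taylor_jet m₁ hm, eval_jet_prod _ _ _ hz, eval_derivative_prod _ _ hz, eval_prod]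
    at hpoch
  simp only [eval_sub, eval_X, eval_C] at hpoch
  have hP0 : ∏ l ∈ Icc 2 N, (x₀ 1 - x₀ l) ≠ 0 := prod_ne_zero_iff.mpr hz
  have hf : (m₁.factorial : ℂ) ≠ 0 := Nat.cast_ne_zero.mpr m₁.factorial_ne_zero
  have hm1 : (m₁ : ℂ) + 1 ≠ 0 := by exact_mod_cast Nat.succ_ne_zero m₁
  have hsum : ∑ n ∈ Icc 2 N, (m₁ * x₁ 1 + 2 * x₁ n) / (x₀ 1 - x₀ n)
      = m₁ * x₁ 1 * ∑ n ∈ Icc 2 N, 1 / (x₀ 1 - x₀ n)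
        + 2 * ∑ n ∈ Icc 2 N, x₁ n / (x₀ 1 - x₀ n) := by
    rw [mul_sum, mul_sum, ← sum_add_distrib]
    exact sum_congr rfl fun n _ => by ring
  rw [hFirst, hpoch, hsum, Nat.factorial_succ]
  push_cast
  field_simp
  ring

/-- The value φ_tt(x_n) is computed from the factorization, where ẍ_n appears with factor `-R`, and
from the coefficients of φ in terms of `y` and x_1. -/
theorem hOther_eq (hN : 1 ≤ N) {n : ℕ} (hn : n ∈ Icc 2 N)
    (hx : ∀ k ∈ Icc 1 N, HasJet (x k) t (x₀ k) (x₁ k) (x₂ k))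
    (hinj : Set.InjOn x₀ (Icc 1 N : Finset ℕ))
    (hy : ∀ j ∈ Icc 1 N, HasJet (y j) t (y₀ j) (y₁ j) (y₂ j))
    (hxy : ∀ j ∈ Icc 1 N, ∀ᶠ s in 𝓝 t, y j s
      = ((X - C (x 1 s)) ^ m₁ * ∏ k ∈ Icc 1 N, (X - C (x k s))).coeff (N + m₁ - j))
    (hfirst : hFirst N m₁ x₀ x₁ y₂ = x₂ 1) :
    hOther N m₁ n x₀ x₁ y₀ y₁ y₂ = x₂ n := by
  have h1mem : 1 ∈ Icc 1 N := by rw [mem_Icc]; omega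
  have hnmem : n ∈ Icc 1 N := by rw [mem_Icc] at hn ⊢; omega
  have hz : ∀ k ∈ (Icc 1 N).erase n, x₀ n - x₀ k ≠ 0 := fun k hk h => by
    rw [mem_erase] at hk
    exact hk.1 (hinj (mem_coe.mpr hnmem) (mem_coe.mpr hk.2) (sub_eq_zero.mp h)).symm
  set R : ℂ := ∏ l ∈ (Icc 1 N).erase n, (x₀ n - x₀ l) with hR
  have hR0 : R ≠ 0 := prod_ne_zero_iff.mpr hz
  obtain ⟨P₂, hP⟩ := HasPolyJet.prod_X_sub_C ((Icc 1 N).erase n)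
    fun k hk => hx k (mem_of_mem_erase hk)
  have hφ := (HasPolyJet.X_sub_C (hx n hnmem)).mul hP
  have hprod : ∀ s, (X - C (x n s)) * ∏ k ∈ (Icc 1 N).erase n, (X - C (x k s))
      = ∏ k ∈ Icc 1 N, (X - C (x k s)) := fun s =>
    mul_prod_erase (Icc 1 N) (fun k => X - C (x k s)) hnmem
  simp_rw [hprod] at hφ
  set φ₂ : ℂ[X] := -C (x₂ n) * ∏ k ∈ (Icc 1 N).erase n, (X - C (x₀ k))
    + 2 * -C (x₁ n) * -∑ k ∈ (Icc 1 N).erase n, C (x₁ k) * ∏ l ∈ ((Icc 1 N).erase n).erase k,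
      (X - C (x₀ l)) + (X - C (x₀ n)) * P₂ with hφ₂
  have hdeg : φ₂.natDegree < N := hφ.natDegree_lt (by omega) (Eventually.of_forall fun s =>
    ⟨monic_prod_X_sub_C _, by rw [natDegree_prod_X_sub_C (fun k => x k s)]; simp⟩)
  have hev : φ₂.eval (x₀ n) = -x₂ n * R
      + 2 * x₁ n * (R * ∑ k ∈ (Icc 1 N).erase n, x₁ k / (x₀ n - x₀ k)) := by
    rw [hφ₂, eval_add, eval_add, eval_mul, eval_mul, eval_mul, eval_jet_prod _ _ _ hz, eval_prod]
    simp only [eval_sub, eval_X, eval_C, eval_neg, eval_mul, sub_self, eval_ofNat]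
    rw [← hR]
    ring
  have hcoeff : ∀ m ∈ Icc 1 N, φ₂.coeff (N - m) =
      (y₂ m + ∑ j ∈ Icc 1 (m - 1), (alpha m₁ m j : ℂ)
        * ((((m - j : ℕ) : ℂ) * ((m - j : ℕ) - 1) * x₀ 1 ^ (m - j - 2) * x₁ 1 ^ 2
            + ((m - j : ℕ) : ℂ) * x₀ 1 ^ (m - j - 1) * x₂ 1) * y₀ j
          + 2 * (((m - j : ℕ) : ℂ) * x₀ 1 ^ (m - j - 1) * x₁ 1) * y₁ j
          + x₀ 1 ^ (m - j) * y₂ j))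
      - (gamma m₁ m : ℂ) * ((m : ℂ) * (m - 1) * x₀ 1 ^ (m - 2) * x₁ 1 ^ 2
            + m * x₀ 1 ^ (m - 1) * x₂ 1) := by
    intro m hm
    rw [mem_Icc] at hm
    have hjet := ((hy m (mem_Icc.mpr hm)).add (HasJet.sum (Icc 1 (m - 1)) fun j hj =>
      (((hx 1 h1mem).pow (m - j)).mul (hy j (by rw [mem_Icc] at hj ⊢; omega))).const_mul
        (alpha m₁ m j : ℂ))).sub (((hx 1 h1mem).pow m).const_mul (gamma m₁ m : ℂ))
    refine ((hφ (N - m)).unique (hjet.congr ?_)).2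
    have hall : ∀ᶠ s in 𝓝 t, ∀ j ∈ Icc 1 N, y j s
      = ((X - C (x 1 s)) ^ m₁ * ∏ k ∈ Icc 1 N, (X - C (x k s))).coeff (N + m₁ - j) :=
      (eventually_all_finset _).mpr hxy
    filter_upwards [hall] with s hs
    rw [coeff_eq_alpha_gamma m₁ (x 1 s) (∏ k ∈ Icc 1 N, (X - C (x k s)))
      (N := N) (by rw [natDegree_prod_X_sub_C (fun k => x k s)]; simp)
      (monic_prod_X_sub_C fun k => x k s) hm.1 hm.2, hs m (mem_Icc.mpr hm)]
    congr 2
    refine sum_congr rfl fun j hj => ?_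
    rw [hs j (by rw [mem_Icc] at hj ⊢; omega)]
    ring
  -- The first bracket in the last term of `hOther` is `R⁻¹` times the formula for ẍ_1. One factor
  -- x_n - x_1 comes from `R`; the other, from the product in `hFirst`, absorbs the minus sign.
  have hbracket : ((x₀ n - x₀ 1) ^ 2)⁻¹
        * (((m₁ + 1).factorial : ℂ)
            * ∏ l ∈ (Icc 2 N).erase n, ((x₀ n - x₀ l) * (x₀ 1 - x₀ l)))⁻¹
        * pochSum N m₁ x₀ y₂
      + x₁ 1 * R⁻¹ * ∑ j ∈ Icc 2 N, (m₁ * x₁ 1 + 2 * x₁ j) / (x₀ 1 - x₀ j)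
      = R⁻¹ * x₂ 1 := by
    have hR' : R = (x₀ n - x₀ 1) * ∏ l ∈ (Icc 2 N).erase n, (x₀ n - x₀ l) := by
      have he : (Icc 1 N).erase n = insert 1 ((Icc 2 N).erase n) := by
        ext k; simp only [mem_erase, mem_insert, mem_Icc]; rw [mem_Icc] at hn; omega
      rw [hR, he, prod_insert]
      simp
    have hQ : ∏ l ∈ Icc 2 N, (x₀ 1 - x₀ l)
        = (x₀ 1 - x₀ n) * ∏ l ∈ (Icc 2 N).erase n, (x₀ 1 - x₀ l) :=
      (mul_prod_erase _ (fun l => x₀ 1 - x₀ l) hn).symm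
    rw [← hfirst, hFirst, hQ, prod_mul_distrib, hR']
    rw [show x₀ 1 - x₀ n = -(x₀ n - x₀ 1) by ring]
    simp only [mul_inv, inv_neg, sq]
    ring
  have hsum : φ₂.eval (x₀ n) =
      ( ∑ m ∈ Icc 1 N, x₀ n ^ (N - m) * y₂ m
      + ∑ m ∈ Icc 1 N, ∑ j ∈ Icc 1 (m - 1),
          (alpha m₁ m j : ℂ) * x₀ n ^ (N - m) * x₀ 1 ^ (m - j) * y₂ j
      - x₁ 1 ^ 2 * ∑ m ∈ Icc 1 N,
          (m : ℂ) * ((m : ℂ) - 1) * (gamma m₁ m : ℂ) * x₀ n ^ (N - m) * x₀ 1 ^ (m - 2)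
      + x₁ 1 ^ 2 * ∑ m ∈ Icc 1 N, ∑ j ∈ Icc 1 (m - 2),
          ((m : ℂ) - j) * ((m : ℂ) - j - 1) * (alpha m₁ m j : ℂ)
            * x₀ n ^ (N - m) * x₀ 1 ^ (m - j - 2) * y₀ j
      + 2 * x₁ 1 * ∑ m ∈ Icc 1 N, ∑ j ∈ Icc 1 (m - 1),
          ((m : ℂ) - j) * (alpha m₁ m j : ℂ) * x₀ n ^ (N - m) * x₀ 1 ^ (m - j - 1) * y₁ j )
      - x₂ 1 * ( ∑ m ∈ Icc 1 N, (m : ℂ) * (gamma m₁ m : ℂ) * x₀ n ^ (N - m) * x₀ 1 ^ (m - 1)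
      - ∑ m ∈ Icc 1 N, ∑ j ∈ Icc 1 (m - 1),
          ((m : ℂ) - j) * (alpha m₁ m j : ℂ) * x₀ n ^ (N - m) * x₀ 1 ^ (m - j - 1) * y₀ j ) := by
    -- The added index `j = m - 1` carries the factor `m - j - 1 = 0`; now all inner sums share one
    -- range.
    have hext : ∀ m : ℕ, ∑ j ∈ Icc 1 (m - 2), ((m : ℂ) - j) * ((m : ℂ) - j - 1) * (alpha m₁ m j : ℂ)
            * x₀ n ^ (N - m) * x₀ 1 ^ (m - j - 2) * y₀ j
        = ∑ j ∈ Icc 1 (m - 1), ((m : ℂ) - j) * ((m : ℂ) - j - 1) * (alpha m₁ m j : ℂ)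
            * x₀ n ^ (N - m) * x₀ 1 ^ (m - j - 2) * y₀ j := by
      intro m
      refine sum_subset (fun j hj => by rw [mem_Icc] at hj ⊢; omega) fun j hj hj' => ?_
      rw [mem_Icc] at hj hj'
      obtain rfl : m = j + 1 := by omega
      push_cast
      ring
    simp_rw [hext]
    rw [eval_eq_sum_range' hdeg, sum_range_eq_sum_Icc]
    simp only [mul_sum, ← sum_add_distrib, ← sum_sub_distrib]
    refine sum_congr rfl fun m hm => ?_
    rw [hcoeff m hm, sub_mul, add_mul, sum_mul]
    have hj : ∀ j ∈ Icc 1 (m - 1), (alpha m₁ m j : ℂ)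
        * ((((m - j : ℕ) : ℂ) * ((m - j : ℕ) - 1) * x₀ 1 ^ (m - j - 2) * x₁ 1 ^ 2
            + ((m - j : ℕ) : ℂ) * x₀ 1 ^ (m - j - 1) * x₂ 1) * y₀ j
          + 2 * (((m - j : ℕ) : ℂ) * x₀ 1 ^ (m - j - 1) * x₁ 1) * y₁ j
          + x₀ 1 ^ (m - j) * y₂ j) * x₀ n ^ (N - m)
        = (alpha m₁ m j : ℂ) * x₀ n ^ (N - m) * x₀ 1 ^ (m - j) * y₂ j
          + x₁ 1 ^ 2 * (((m : ℂ) - j) * ((m : ℂ) - j - 1) * (alpha m₁ m j : ℂ)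
            * x₀ n ^ (N - m) * x₀ 1 ^ (m - j - 2) * y₀ j)
          + 2 * x₁ 1 * (((m : ℂ) - j) * (alpha m₁ m j : ℂ) * x₀ n ^ (N - m)
            * x₀ 1 ^ (m - j - 1) * y₁ j)
          + x₂ 1 * (((m : ℂ) - j) * (alpha m₁ m j : ℂ) * x₀ n ^ (N - m)
            * x₀ 1 ^ (m - j - 1) * y₀ j) := by
      intro j hj
      rw [mem_Icc] at hj
      rw [Nat.cast_sub (by omega)]
      ring
    rw [sum_congr rfl hj]
    simp only [sum_add_distrib]
    simp only [← mul_sum]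
    ring
  rw [hOther, ← hR, hbracket]
  have hx2 : x₂ n = ∑ l ∈ (Icc 1 N).erase n, 2 * x₁ n * x₁ l / (x₀ n - x₀ l)
      - R⁻¹ * φ₂.eval (x₀ n) := by
    rw [hev]
    have : ∑ l ∈ (Icc 1 N).erase n, 2 * x₁ n * x₁ l / (x₀ n - x₀ l)
        = 2 * x₁ n * ∑ l ∈ (Icc 1 N).erase n, x₁ l / (x₀ n - x₀ l) := by
      rw [mul_sum]; exact sum_congr rfl fun l _ => by ring
    rw [this]
    field_simp
    ring
  rw [hx2, hsum]
  ring

end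

/-! ### Vectors with entries numbered from `1` -/

theorem ent_succ {N : ℕ} (x : Fin N → ℂ) (i : Fin N) : ent x (i + 1) = x i := by
  have h : 1 ≤ (i : ℕ) + 1 ∧ (i : ℕ) + 1 ≤ N := by omega
  simp [ent, h]

theorem exists_ent {N k : ℕ} (hk : k ∈ Icc 1 N) :
    ∃ i : Fin N, (i : ℕ) + 1 = k ∧ ∀ x : Fin N → ℂ, ent x k = x i := by
  rw [mem_Icc] at hk
  obtain ⟨k, rfl⟩ : ∃ l, k = l + 1 := ⟨k - 1, by omega⟩
  exact ⟨⟨k, by omega⟩, rfl, fun x => ent_succ x ⟨k, by omega⟩⟩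

theorem rootPoly_eq {N : ℕ} (m₁ : ℕ) (x : Fin N → ℂ) :
    rootPoly m₁ x = (X - C (ent x 1)) ^ m₁ * ∏ k ∈ Icc 1 N, (X - C (ent x k)) := by
  rw [rootPoly]
  congr 1
  have h := Fin.prod_univ_eq_prod_range (fun i => (X - C (ent x (i + 1)) : ℂ[X])) N
  simp only [ent_succ] at h
  rw [h, range_eq_Ico, prod_Ico_add' (fun i => (X - C (ent x i) : ℂ[X])) 0 N 1]
  rfl

theorem injOn_ent {N : ℕ} {x : Fin N → ℂ} (hx : Function.Injective x) :
    Set.InjOn (ent x) (Icc 1 N : Finset ℕ) := by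
  intro k hk l hl hkl
  obtain ⟨i, rfl, hi⟩ := exists_ent (mem_coe.mp hk)
  obtain ⟨j, rfl, hj⟩ := exists_ent (mem_coe.mp hl)
  rw [hi, hj] at hkl
  rw [hx hkl]

theorem ent_firstCoeffs {N : ℕ} (m₁ : ℕ) (x : Fin N → ℂ) {j : ℕ} (hj : j ∈ Icc 1 N) :
    ent (firstCoeffs m₁ x) j = (rootPoly m₁ x).coeff (N + m₁ - j) := by
  obtain ⟨i, rfl, hi⟩ := exists_ent hj
  rw [hi, firstCoeffs]

theorem hasJet_ent {N : ℕ} {x : ℝ → Fin N → ℂ} {t : ℝ}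
    (hx : ∀ᶠ s in 𝓝 t, DifferentiableAt ℝ x s) (hx2 : DifferentiableAt ℝ (deriv x) t) (k : ℕ) :
    HasJet (fun s => ent (x s) k) t (ent (x t) k) (ent (deriv x t) k)
      (ent (deriv (deriv x) t) k) := by
  refine HasJet.of_eventually (fun s => ent (deriv x s) k) rfl ?_ rfl ?_
  · filter_upwards [hx] with s hs
    by_cases hk : 1 ≤ k ∧ k ≤ N
    · simpa only [ent, dif_pos hk] using hasDerivAt_pi.mp hs.hasDerivAt _
    · simpa only [ent, dif_neg hk] using hasDerivAt_const s (0 : ℂ)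
  · by_cases hk : 1 ≤ k ∧ k ≤ N
    · simpa only [ent, dif_pos hk] using hasDerivAt_pi.mp hx2.hasDerivAt _
    · simpa only [ent, dif_neg hk] using hasDerivAt_const t (0 : ℂ)

/-- This is (a) with hypotheses only at and near `t`, so that it also applies to auxiliary curves
whose zeros are distinct at one instant only. -/
theorem deriv_deriv_eq_h {N m₁ : ℕ} (hm : 1 ≤ m₁) {x y : ℝ → Fin N → ℂ} {t : ℝ}
    (hinj : Function.Injective (x t))
    (hx : ∀ᶠ s in 𝓝 t, DifferentiableAt ℝ x s) (hx2 : DifferentiableAt ℝ (deriv x) t)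
    (hy : ∀ᶠ s in 𝓝 t, DifferentiableAt ℝ y s) (hy2 : DifferentiableAt ℝ (deriv y) t)
    (hxy : ∀ᶠ s in 𝓝 t, y s = firstCoeffs m₁ (x s)) :
    deriv (deriv x) t = h m₁ (x t) (deriv x t) (y t) (deriv y t) (deriv (deriv y) t) := by
  funext i
  have hN : 1 ≤ N := by have := i.isLt; omega
  have hxy' : ∀ j ∈ Icc 1 N, ∀ᶠ s in 𝓝 t, ent (y s) j = ((X - C (ent (x s) 1)) ^ m₁
      * ∏ k ∈ Icc 1 N, (X - C (ent (x s) k))).coeff (N + m₁ - j) := fun j hj => by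
    filter_upwards [hxy] with s hs
    rw [hs, ent_firstCoeffs m₁ _ hj, rootPoly_eq]
  have hfirst := hFirst_eq hN hm (fun k _ => hasJet_ent hx hx2 k) (injOn_ent hinj)
    (fun k _ => hasJet_ent hy hy2 k) hxy'
  rw [h]
  split_ifs with hi
  · rw [hfirst, ← hi, ent_succ]
  · have hi' : (i : ℕ) + 1 ∈ Icc 2 N := by rw [mem_Icc]; omega
    rw [hOther_eq hN hi' (fun k _ => hasJet_ent hx hx2 k) (injOn_ent hinj)
      (fun k _ => hasJet_ent hy hy2 k) hxy' hfirst, ent_succ]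

/-! ### Smoothness of the coefficient map -/

section

variable {E : Type*} [NormedAddCommGroup E] [NormedSpace ℂ E] {n : WithTop ℕ∞}

theorem contDiff_coeff_mul {p q : E → ℂ[X]} (hp : ∀ k, ContDiff ℂ n fun x => (p x).coeff k)
    (hq : ∀ k, ContDiff ℂ n fun x => (q x).coeff k) (k : ℕ) :
    ContDiff ℂ n fun x => (p x * q x).coeff k := by
  simp only [coeff_mul]
  exact ContDiff.sum fun i _ => (hp i.1).mul (hq i.2)

theorem contDiff_coeff_one (k : ℕ) : ContDiff ℂ n fun _ : E => (1 : ℂ[X]).coeff k :=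
  contDiff_const

theorem contDiff_coeff_pow {p : E → ℂ[X]} (hp : ∀ k, ContDiff ℂ n fun x => (p x).coeff k) (m : ℕ)
    (k : ℕ) : ContDiff ℂ n fun x => (p x ^ m).coeff k := by
  induction m generalizing k with
  | zero => simpa only [pow_zero] using contDiff_coeff_one k
  | succ m ih => simpa only [pow_succ] using contDiff_coeff_mul ih hp k

theorem contDiff_coeff_prod {ι : Type*} (S : Finset ι) {p : ι → E → ℂ[X]}
    (hp : ∀ i k, ContDiff ℂ n fun x => (p i x).coeff k) (k : ℕ) :
    ContDiff ℂ n fun x => (∏ i ∈ S, p i x).coeff k := by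
  classical
  induction S using Finset.induction_on generalizing k with
  | empty => simpa only [prod_empty] using contDiff_coeff_one k
  | insert i S hi ih => simpa only [prod_insert hi] using contDiff_coeff_mul (hp i) ih k

theorem contDiff_coeff_X_sub_C {f : E → ℂ} (hf : ContDiff ℂ n f) (k : ℕ) :
    ContDiff ℂ n fun x => (X - C (f x)).coeff k := by
  rcases k with _ | k
  · simpa using hf.neg
  · simpa [coeff_X, coeff_C] using contDiff_const

end

theorem contDiff_ent {N : ℕ} {n : WithTop ℕ∞} (k : ℕ) :
    ContDiff ℂ n fun x : Fin N → ℂ => ent x k := by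
  by_cases hk : 1 ≤ k ∧ k ≤ N
  · simpa only [ent, dif_pos hk] using contDiff_apply ℂ ℂ _
  · simpa only [ent, dif_neg hk] using contDiff_const

theorem contDiff_firstCoeffs {N : ℕ} (m₁ : ℕ) {n : WithTop ℕ∞} :
    ContDiff ℂ n (firstCoeffs (N := N) m₁) := by
  rw [contDiff_pi]
  intro j
  exact contDiff_coeff_mul (contDiff_coeff_pow (contDiff_coeff_X_sub_C (contDiff_ent 1)) m₁)
    (contDiff_coeff_prod univ fun i => contDiff_coeff_X_sub_C (contDiff_apply ℂ ℂ i)) _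

theorem vieta_eq {N : ℕ} (m₁ : ℕ) (x : Fin N → ℂ) : vieta m₁ x = firstCoeffs m₁ x := by
  funext j
  set s : Multiset ℂ := Multiset.replicate m₁ (ent x 1) + (univ : Finset (Fin N)).val.map x with hs
  have hr : rootPoly m₁ x = (s.map fun a => X - C a).prod := by
    rw [hs, rootPoly, Multiset.map_add, Multiset.prod_add, Multiset.map_replicate,
      Multiset.prod_replicate, Multiset.map_map]
    rfl
  have hcard : s.card = N + m₁ := by
    rw [hs]; simp [add_comm]
  have hj := j.isLt
  rw [vieta, firstCoeffs, hr, Multiset.prod_X_sub_C_coeff _ (by rw [hcard]; omega), hcard,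
    show N + m₁ - (N + m₁ - ((j : ℕ) + 1)) = j + 1 by omega]

/-- Time is real but the partial derivatives are complex: the real derivative of the coefficient map
is the restriction of its complex one, which is expanded in the coordinate directions. -/
theorem vietaDot_eq {N : ℕ} (m₁ : ℕ) (x v : Fin N → ℂ) :
    vietaDot m₁ x v = fderiv ℝ (firstCoeffs m₁) x v := by
  have hd : DifferentiableAt ℂ (firstCoeffs (N := N) m₁) x :=
    (contDiff_firstCoeffs m₁ (n := 1)).differentiable one_ne_zero x
  rw [hd.fderiv_restrictScalars ℝ]
  change _ = fderiv ℂ (firstCoeffs m₁) x v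
  funext j
  have hpart : ∀ k : Fin N, HasDerivAt (fun s : ℂ => firstCoeffs m₁ (Function.update x k s) j)
      (fderiv ℂ (firstCoeffs m₁) x (Pi.single k 1) j) (x k) := by
    intro k
    have h1 := hasDerivAt_update x k (x k)
    have h2 : HasFDerivAt (firstCoeffs m₁) (fderiv ℂ (firstCoeffs m₁) x)
        (Function.update x k (x k)) := by
      rw [Function.update_eq_self]; exact hd.hasFDerivAt
    exact hasDerivAt_pi.mp (h2.comp_hasDerivAt (x k) h1) j
  have hfun : ∀ k : Fin N, deriv (fun s : ℂ => (-1) ^ ((j : ℕ) + 1) *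
      (Multiset.replicate m₁ (ent (Function.update x k s) 1)
        + (univ : Finset (Fin N)).val.map (Function.update x k s)).esymm (j + 1)) (x k)
      = fderiv ℂ (firstCoeffs m₁) x (Pi.single k 1) j := fun k => by
    rw [← (hpart k).deriv]
    congr 1
    funext s
    exact congrFun (vieta_eq m₁ (Function.update x k s)) j
  have hv : v = ∑ k, v k • (Pi.single k 1 : Fin N → ℂ) := by
    funext i
    simp [Finset.sum_apply, Pi.single_apply]
  rw [vietaDot, mul_sum]
  conv_rhs => rw [hv, map_sum, Finset.sum_apply]
  refine sum_congr rfl fun k _ => ?_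
  rw [map_smul, Pi.smul_apply, ← hfun k, deriv_const_mul_field, smul_eq_mul]
  ring

/-! ### Second derivatives of compositions -/

section

variable {E F : Type*} [NormedAddCommGroup E] [NormedSpace ℝ E] [NormedAddCommGroup F]
  [NormedSpace ℝ F] {f : E → F} {y : ℝ → E} {t : ℝ}

theorem eventually_hasDerivAt_comp (hf : ContDiffAt ℝ 2 f (y t))
    (hy : ∀ᶠ s in 𝓝 t, DifferentiableAt ℝ y s) :
    ∀ᶠ s in 𝓝 t, HasDerivAt (fun s => f (y s)) (fderiv ℝ f (y s) (deriv y s)) s := by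
  have hc : ∀ᶠ s in 𝓝 t, ContDiffAt ℝ 2 f (y s) :=
    hy.self_of_nhds.continuousAt.eventually (hf.eventually (by simp))
  filter_upwards [hc, hy] with s hs h's
  exact (hs.differentiableAt two_ne_zero).hasFDerivAt.comp_hasDerivAt s h's.hasDerivAt

theorem hasDerivAt_deriv_comp (hf : ContDiffAt ℝ 2 f (y t))
    (hy : ∀ᶠ s in 𝓝 t, DifferentiableAt ℝ y s) (hy2 : DifferentiableAt ℝ (deriv y) t) :
    HasDerivAt (deriv fun s => f (y s)) (fderiv ℝ (fderiv ℝ f) (y t) (deriv y t) (deriv y t)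
      + fderiv ℝ f (y t) (deriv (deriv y) t)) t := by
  have h1 : DifferentiableAt ℝ (fderiv ℝ f) (y t) :=
    (hf.fderiv_right (m := 1) (by norm_num)).differentiableAt one_ne_zero
  have h2 := (h1.hasFDerivAt.comp_hasDerivAt t hy.self_of_nhds.hasDerivAt).clm_apply
    hy2.hasDerivAt
  refine h2.congr_of_eventuallyEq ?_
  filter_upwards [eventually_hasDerivAt_comp hf hy] with s hs using hs.deriv

end

/-! ### Nondegeneracy of the coefficient map at distinct zeros -/

theorem contDiff_real_firstCoeffs {N : ℕ} (m₁ : ℕ) : ContDiff ℝ 2 (firstCoeffs (N := N) m₁) :=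
  (contDiff_firstCoeffs m₁).restrict_scalars ℝ

/-- The second derivatives of the coefficients determine those of the zeros. -/
theorem h_second_derivative {N m₁ : ℕ} (hm : 1 ≤ m₁) {x : Fin N → ℂ} (hx : Function.Injective x)
    (v w : Fin N → ℂ) :
    h m₁ x v (firstCoeffs m₁ x) (fderiv ℝ (firstCoeffs m₁) x v)
      (fderiv ℝ (fderiv ℝ (firstCoeffs m₁)) x v v + fderiv ℝ (firstCoeffs m₁) x w) = w := by
  -- A curve with position `x`, velocity `v` and acceleration `w` at time 0.
  set c : ℝ → Fin N → ℂ := fun s => x + s • v + (s ^ 2 / 2) • w with hc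
  have hc1 : ∀ s, HasDerivAt c (v + s • w) s := fun s => by
    have h1 : HasDerivAt (fun s : ℝ => s • v) ((1 : ℝ) • v) s := (hasDerivAt_id s).smul_const v
    have h2 : HasDerivAt (fun s : ℝ => (s ^ 2 / 2) • w) ((((2 : ℕ) : ℝ) * s ^ (2 - 1) / 2) • w) s :=
      ((hasDerivAt_pow 2 s).div_const 2).smul_const w
    have h3 := (h1.const_add x).add h2
    exact h3.congr_deriv (by simp)
  have hd : deriv c = fun s => v + s • w := funext fun s => (hc1 s).deriv
  have hd2 : HasDerivAt (deriv c) w 0 := by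
    rw [hd]
    have h1 : HasDerivAt (fun s : ℝ => s • w) ((1 : ℝ) • w) 0 := (hasDerivAt_id 0).smul_const w
    simpa using h1.const_add v
  have e0 : c 0 = x := by simp [hc]
  have e1 : deriv c 0 = v := by simp [hd]
  have hev : ∀ᶠ s in 𝓝 (0 : ℝ), DifferentiableAt ℝ c s :=
    Eventually.of_forall fun s => (hc1 s).differentiableAt
  have hV := (contDiff_real_firstCoeffs (N := N) m₁).contDiffAt (x := c 0)
  have hy1 := eventually_hasDerivAt_comp hV hev
  have hy2 := hasDerivAt_deriv_comp hV hev hd2.differentiableAt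
  have key := deriv_deriv_eq_h (m₁ := m₁) hm (by rw [e0]; exact hx) hev hd2.differentiableAt
    (hy1.mono fun s hs => hs.differentiableAt) hy2.differentiableAt (Eventually.of_forall fun _ => rfl)
  rw [hy1.self_of_nhds.deriv, hy2.deriv, hd2.deriv, e0, e1] at key
  exact key.symm

/-- At velocity 0, `h` recovers `w` from the image of `w` under the derivative, so no Jacobian
determinant is needed. -/
theorem fderiv_firstCoeffs_injective {N m₁ : ℕ} (hm : 1 ≤ m₁) {x : Fin N → ℂ}
    (hx : Function.Injective x) : Function.Injective (fderiv ℝ (firstCoeffs m₁) x) := by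
  intro w w' hww
  rw [← h_second_derivative hm hx 0 w, hww, h_second_derivative hm hx 0 w']

/-- By finite dimension the derivative is also surjective. Every ÿ is therefore D²V(v, v) + DV w for
some `w`, which `h` recovers. -/
theorem h_injective {N m₁ : ℕ} (hm : 1 ≤ m₁) {x : Fin N → ℂ} (hx : Function.Injective x)
    (v : Fin N → ℂ) : Function.Injective
      (h m₁ x v (firstCoeffs m₁ x) (fderiv ℝ (firstCoeffs m₁) x v)) := by
  have hsurj : Function.Surjective (fderiv ℝ (firstCoeffs m₁) x) :=
    LinearMap.surjective_of_injective (f := (fderiv ℝ (firstCoeffs m₁) x).toLinearMap)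
      (fderiv_firstCoeffs_injective hm hx)
  intro z z' hzz
  obtain ⟨w, hw⟩ := hsurj (z - fderiv ℝ (fderiv ℝ (firstCoeffs m₁)) x v v)
  obtain ⟨w', hw'⟩ := hsurj (z' - fderiv ℝ (fderiv ℝ (firstCoeffs m₁)) x v v)
  have h1 := h_second_derivative hm hx v w
  have h2 := h_second_derivative hm hx v w'
  rw [hw, add_sub_cancel] at h1
  rw [hw', add_sub_cancel] at h2
  have : w = w' := by rw [← h1, ← h2, hzz]
  rw [this, hw'] at hw
  exact (sub_left_injective hw).symm

/-- The derivative of the coefficient map as a linear isomorphism. -/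
noncomputable def firstCoeffsDerivEquiv {N m₁ : ℕ} (hm : 1 ≤ m₁) {x : Fin N → ℂ}
    (hx : Function.Injective x) : (Fin N → ℂ) ≃L[ℝ] (Fin N → ℂ) :=
  (LinearEquiv.ofInjectiveEndo (fderiv ℝ (firstCoeffs m₁) x).toLinearMap
    (fderiv_firstCoeffs_injective hm hx)).toContinuousLinearEquiv

theorem hasFDerivAt_firstCoeffs {N m₁ : ℕ} (hm : 1 ≤ m₁) {x : Fin N → ℂ}
    (hx : Function.Injective x) :
    HasFDerivAt (firstCoeffs m₁) (firstCoeffsDerivEquiv hm hx : (Fin N → ℂ) →L[ℝ] (Fin N → ℂ)) x := by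
  have : (firstCoeffsDerivEquiv hm hx : (Fin N → ℂ) →L[ℝ] (Fin N → ℂ))
      = fderiv ℝ (firstCoeffs m₁) x := by ext1; rfl
  rw [this]
  exact ((contDiff_real_firstCoeffs m₁).differentiable two_ne_zero x).hasFDerivAt

/-! ### Correspondence between the two systems -/

section

variable {N m₁ : ℕ} {U : Set ((Fin N → ℂ) × (Fin N → ℂ))}
  {f : (Fin N → ℂ) → (Fin N → ℂ) → (Fin N → ℂ)}

theorem mem_nBodyDomain {p : (Fin N → ℂ) × (Fin N → ℂ)} : p ∈ nBodyDomain m₁ U ↔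
    Function.Injective p.1 ∧ (firstCoeffs m₁ p.1, fderiv ℝ (firstCoeffs m₁) p.1 p.2) ∈ U := by
  rw [nBodyDomain, Set.mem_ofPred_eq, vieta_eq, vietaDot_eq]

theorem nBodyField_eq (x v : Fin N → ℂ) : nBodyField m₁ f x v =
    h m₁ x v (firstCoeffs m₁ x) (fderiv ℝ (firstCoeffs m₁) x v)
      (f (firstCoeffs m₁ x) (fderiv ℝ (firstCoeffs m₁) x v)) := by
  rw [nBodyField, vieta_eq, vietaDot_eq]

theorem IsSolutionOn.eventually_differentiableAt {D : Set ((Fin N → ℂ) × (Fin N → ℂ))}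
    {F : (Fin N → ℂ) → (Fin N → ℂ) → (Fin N → ℂ)} {J : Set ℝ} {z : ℝ → Fin N → ℂ}
    (hz : IsSolutionOn D F J z) (hJ : IsOpen J) {t : ℝ} (ht : t ∈ J) :
    ∀ᶠ s in 𝓝 t, DifferentiableAt ℝ z s := by
  filter_upwards [hJ.mem_nhds ht] with s hs using (hz s hs).2.1

theorem deriv_firstCoeffs_comp {x : ℝ → Fin N → ℂ} {t : ℝ} (hx : DifferentiableAt ℝ x t) :
    HasDerivAt (fun s => firstCoeffs m₁ (x s)) (fderiv ℝ (firstCoeffs m₁) (x t) (deriv x t)) t :=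
  ((contDiff_real_firstCoeffs m₁).differentiable two_ne_zero (x t)).hasFDerivAt.comp_hasDerivAt t
    hx.hasDerivAt

/-- The acceleration ẍ equals `h` at the true ÿ by (a), and `h` at `f(y, ẏ)` by the equation of
motion; injectivity of `h` identifies the two arguments. -/
theorem isSolutionOn_firstCoeffs (hm : 1 ≤ m₁) {J : Set ℝ} (hJ : IsOpen J) {x : ℝ → Fin N → ℂ}
    (hx : IsSolutionOn (nBodyDomain m₁ U) (nBodyField m₁ f) J x) :
    IsSolutionOn U f J fun t => firstCoeffs m₁ (x t) := by
  intro t ht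
  have hev := hx.eventually_differentiableAt hJ ht
  obtain ⟨hmem, hd, hd2, heq⟩ := hx t ht
  rw [mem_nBodyDomain] at hmem
  have hV := (contDiff_real_firstCoeffs (N := N) m₁).contDiffAt (x := x t)
  have hy1 := eventually_hasDerivAt_comp hV hev
  have hy2 := hasDerivAt_deriv_comp hV hev hd2
  have key := deriv_deriv_eq_h (m₁ := m₁) hm hmem.1 hev hd2
    (hy1.mono fun s hs => hs.differentiableAt) hy2.differentiableAt
    (Eventually.of_forall fun _ => rfl)
  have hdy := hy1.self_of_nhds.deriv
  refine ⟨by rw [hdy]; exact hmem.2, hy1.self_of_nhds.differentiableAt, hy2.differentiableAt, ?_⟩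
  rw [heq, nBodyField_eq, hdy] at key
  rw [hdy]
  exact (h_injective hm hmem.1 _ key).symm

/-- The trajectory of the coefficients that belongs to a trajectory of the zeros. -/
noncomputable def coeffTrajectory (hm : 1 ≤ m₁) (T : Trajectory (nBodyDomain m₁ U) (nBodyField m₁ f)) :
    Trajectory U f where
  J := T.J
  t₀ := T.t₀
  z := fun t => firstCoeffs m₁ (T.z t)
  isOpen := T.isOpen
  ordConnected := T.ordConnected
  mem := T.mem
  sol := isSolutionOn_firstCoeffs hm T.isOpen T.sol

theorem isOpen_injective : IsOpen {x : Fin N → ℂ | Function.Injective x} := by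
  have e : {x : Fin N → ℂ | Function.Injective x}
      = ⋂ i : Fin N, ⋂ j : Fin N, {x | i ≠ j → x i ≠ x j} := by
    ext x
    simp only [Set.mem_ofPred_eq, Set.mem_iInter]
    exact ⟨fun h i j hij => fun he => hij (h he), fun h i j he => by
      by_contra hij; exact h i j hij he⟩
  rw [e]
  refine isOpen_iInter_of_finite fun i => isOpen_iInter_of_finite fun j => ?_
  by_cases hij : i = j
  · simp [hij]
  · simp only [ne_eq, hij, not_false_eq_true, forall_const]
    exact isOpen_ne_fun (continuous_apply i) (continuous_apply j)

/-- The solution is lifted through the local inverse `G` of the coefficient map at `x₀`, on a time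
interval so short that `G` stays C² with distinct zeros; (a) then gives the equation of motion. -/
theorem exists_nBody_solution (hm : 1 ≤ m₁) {t₀ : ℝ} {x₀ v₀ : Fin N → ℂ}
    (hx₀ : Function.Injective x₀) (T : Trajectory U f) (ht : T.t₀ = t₀)
    (hz : T.z t₀ = firstCoeffs m₁ x₀)
    (hdz : deriv T.z t₀ = fderiv ℝ (firstCoeffs m₁) x₀ v₀) :
    ∃ S : Trajectory (nBodyDomain m₁ U) (nBodyField m₁ f),
      S.t₀ = t₀ ∧ S.z t₀ = x₀ ∧ deriv S.z t₀ = v₀ := by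
  have hV := (contDiff_real_firstCoeffs (N := N) m₁).contDiffAt (x := x₀)
  have hV' := hasFDerivAt_firstCoeffs hm hx₀
  have hstrict := hV.hasStrictFDerivAt' hV' two_ne_zero
  set G := hV.localInverse hV' two_ne_zero with hG
  have hG0 : G (firstCoeffs m₁ x₀) = x₀ := hV.localInverse_apply_image hV' two_ne_zero
  have hGC : ContDiffAt ℝ 2 G (firstCoeffs m₁ x₀) := hV.to_localInverse hV' two_ne_zero
  have hinv : ∀ᶠ y in 𝓝 (firstCoeffs m₁ x₀), firstCoeffs m₁ (G y) = y :=
    hstrict.eventually_right_inverse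
  have hGinj : ∀ᶠ y in 𝓝 (firstCoeffs m₁ x₀), Function.Injective (G y) :=
    hGC.continuousAt.eventually (isOpen_injective.mem_nhds (by rw [hG0]; exact hx₀))
  have htJ : t₀ ∈ T.J := ht ▸ T.mem
  have hcont : Tendsto T.z (𝓝 t₀) (𝓝 (firstCoeffs m₁ x₀)) := by
    rw [← hz]; exact (T.sol t₀ htJ).2.1.continuousAt
  have hall : ∀ᶠ s in 𝓝 t₀, s ∈ T.J ∧ ContDiffAt ℝ 2 G (T.z s) ∧
      firstCoeffs m₁ (G (T.z s)) = T.z s ∧ Function.Injective (G (T.z s)) := by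
    filter_upwards [T.isOpen.mem_nhds htJ, hcont.eventually (hGC.eventually (by simp)),
      hcont.eventually hinv, hcont.eventually hGinj] with s h1 h2 h3 h4 using ⟨h1, h2, h3, h4⟩
  obtain ⟨ε, hε, hball⟩ := Metric.eventually_nhds_iff_ball.mp hall
  have hmem : ∀ t ∈ Metric.ball t₀ ε, ∀ᶠ s in 𝓝 t, s ∈ Metric.ball t₀ ε := fun t ht =>
    Metric.isOpen_ball.mem_nhds ht
  have hderiv : ∀ t ∈ Metric.ball t₀ ε,
      deriv T.z t = fderiv ℝ (firstCoeffs m₁) (G (T.z t)) (deriv (fun s => G (T.z s)) t) := by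
    intro t ht
    obtain ⟨h1, h2, _, _⟩ := hball t ht
    have hd := (eventually_hasDerivAt_comp h2
      (T.sol.eventually_differentiableAt T.isOpen h1)).self_of_nhds.differentiableAt
    have he : (fun s => firstCoeffs m₁ (G (T.z s))) =ᶠ[𝓝 t] T.z :=
      (hmem t ht).mono fun s hs => (hball s hs).2.2.1
    rw [← he.deriv_eq]
    exact (deriv_firstCoeffs_comp hd).deriv
  have ht₀ : t₀ ∈ Metric.ball t₀ ε := Metric.mem_ball_self hε
  refine ⟨⟨Metric.ball t₀ ε, t₀, fun s => G (T.z s), Metric.isOpen_ball,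
    by rw [Real.ball_eq_Ioo]; exact Set.ordConnected_Ioo, ht₀, ?_⟩, rfl, ?_, ?_⟩
  · intro t ht
    obtain ⟨h1, h2, h3, h4⟩ := hball t ht
    obtain ⟨hU, hd, hd2, heq⟩ := T.sol t h1
    have hev := T.sol.eventually_differentiableAt T.isOpen h1
    have hx1 := eventually_hasDerivAt_comp h2 hev
    have hx2 := hasDerivAt_deriv_comp h2 hev hd2
    have key := deriv_deriv_eq_h (m₁ := m₁) hm h4 (hx1.mono fun s hs => hs.differentiableAt)
      hx2.differentiableAt hev hd2 ((hmem t ht).mono fun s hs => (hball s hs).2.2.1.symm)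
    refine ⟨?_, hx1.self_of_nhds.differentiableAt, hx2.differentiableAt, ?_⟩
    · rw [mem_nBodyDomain]
      refine ⟨h4, ?_⟩
      simp only
      rw [h3, ← hderiv t ht]
      exact hU
    · rw [key, nBodyField_eq, h3, ← hderiv t ht, heq]
  · simp only
    rw [hz, hG0]
  -- Both velocities have the same image under the injective derivative at `x₀`.
  · have := hderiv t₀ ht₀
    rw [hdz, hz, hG0] at this
    exact (fderiv_firstCoeffs_injective hm hx₀ this).symm

/-- The set of times of agreement is open, because the coefficient map is locally injective at
distinct zeros, and relatively closed by continuity; an interval is connected. -/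
theorem eqOn_of_firstCoeffs_eqOn (hm : 1 ≤ m₁) {S : Set ℝ} (hS : IsOpen S) (hS' : S.OrdConnected)
    {x x' : ℝ → Fin N → ℂ} (hx : ∀ t ∈ S, ContinuousAt x t) (hx' : ∀ t ∈ S, ContinuousAt x' t)
    (hinj : ∀ t ∈ S, Function.Injective (x t))
    (heq : ∀ t ∈ S, firstCoeffs m₁ (x t) = firstCoeffs m₁ (x' t))
    {t₀ : ℝ} (ht₀ : t₀ ∈ S) (h0 : x t₀ = x' t₀) : Set.EqOn x x' S := by
  set u : Set ℝ := {t | t ∈ S ∧ x t = x' t} with hu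
  have huo : IsOpen u := by
    rw [isOpen_iff_mem_nhds]
    rintro t ⟨ht, hxt⟩
    have hstrict := ((contDiff_real_firstCoeffs (N := N) m₁).contDiffAt
      (x := x t)).hasStrictFDerivAt' (hasFDerivAt_firstCoeffs hm (hinj t ht)) two_ne_zero
    have hleft := hstrict.eventually_left_inverse
    have hc : Tendsto x' (𝓝 t) (𝓝 (x t)) := by rw [hxt]; exact hx' t ht
    filter_upwards [hS.mem_nhds ht, (hx t ht).eventually hleft, hc.eventually hleft] with s hs h1 h2
    exact ⟨hs, by rw [← h1, heq s hs, h2]⟩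
  have hsub := hS'.isPreconnected.subset_of_closure_inter_subset huo ⟨t₀, ht₀, ht₀, h0⟩ (by
    rintro t ⟨htc, ht⟩
    refine ⟨ht, ?_⟩
    by_contra hne
    have hev : ∀ᶠ s in 𝓝 t, x s ≠ x' s :=
      (((hx t ht).sub (hx' t ht)).eventually_ne (sub_ne_zero.mpr hne)).mono fun s =>
        sub_ne_zero.mp
    exact (mem_closure_iff_frequently.mp htc) (hev.mono fun s hs h => hs h.2))
  exact fun t ht => (hsub ht).2

end

/-! ### Closure properties of the functions obtained by algebraic operations -/

namespace AlgObtainable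

variable {ι κ : Type*} {J : ι → Set ℝ} {B : Set (ι → ℝ → ℂ)}

/-- With `Φ = coeffTrajectory hm`, this carries the formulas for `y` over to trajectories of the
zeros. The time intervals must agree because the `inv` and `root` conditions refer to them. -/
theorem comap {J' : κ → Set ℝ} {B' : Set (κ → ℝ → ℂ)} (Φ : ι → κ) (hJ : ∀ i, J' (Φ i) = J i)
    (hB : ∀ g ∈ B', AlgObtainable J B fun i t => g (Φ i) t) {g : κ → ℝ → ℂ}
    (hg : AlgObtainable J' B' g) : AlgObtainable J B fun i t => g (Φ i) t := by
  induction hg with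
  | base g hg => exact hB g hg
  | const c => exact const c
  | add g g' _ _ h h' => exact add _ _ h h'
  | mul g g' _ _ h h' => exact mul _ _ h h'
  | inv g _ h0 h => exact inv _ h fun i t ht => h0 (Φ i) t (by rw [hJ]; exact ht)
  | root d c _ g hcont hroot h =>
    exact root d (fun k i t => c k (Φ i) t) h _ (fun i => by rw [← hJ]; exact hcont (Φ i))
      fun i t ht => hroot (Φ i) t (by rw [hJ]; exact ht)

theorem neg {g : ι → ℝ → ℂ} (hg : AlgObtainable J B g) : AlgObtainable J B fun i t => -g i t := by
  simpa only [neg_one_mul] using mul _ _ (const (-1)) hg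

theorem sum {α : Type*} (S : Finset α) {g : α → ι → ℝ → ℂ} (hg : ∀ a ∈ S, AlgObtainable J B (g a)) :
    AlgObtainable J B fun i t => ∑ a ∈ S, g a i t := by
  classical
  induction S using Finset.induction_on with
  | empty => simpa only [sum_empty] using const 0
  | insert a S ha ih =>
    simpa only [sum_insert ha] using
      add _ _ (hg a (mem_insert_self _ _)) (ih fun b hb => hg b (mem_insert_of_mem hb))

theorem pow {g : ι → ℝ → ℂ} (hg : AlgObtainable J B g) (k : ℕ) :
    AlgObtainable J B fun i t => g i t ^ k := by
  induction k with
  | zero => simpa only [pow_zero] using const 1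
  | succ k ih => simpa only [pow_succ] using mul _ _ ih hg

end AlgObtainable

/-- All coefficients of the polynomial-valued function `p` are obtained by algebraic operations. -/
def PolyObtainable {ι : Type*} (J : ι → Set ℝ) (B : Set (ι → ℝ → ℂ)) (p : ι → ℝ → ℂ[X]) : Prop :=
  ∀ k, AlgObtainable J B fun i t => (p i t).coeff k

namespace PolyObtainable

variable {ι : Type*} {J : ι → Set ℝ} {B : Set (ι → ℝ → ℂ)} {p q : ι → ℝ → ℂ[X]}

theorem const (p : ℂ[X]) : PolyObtainable J B fun _ _ => p := fun k => .const (p.coeff k)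

theorem C {g : ι → ℝ → ℂ} (hg : AlgObtainable J B g) :
    PolyObtainable J B fun i t => Polynomial.C (g i t) := fun k => by
  rcases k with _ | k
  · simpa using hg
  · simpa [coeff_C] using AlgObtainable.const 0

theorem add (hp : PolyObtainable J B p) (hq : PolyObtainable J B q) :
    PolyObtainable J B fun i t => p i t + q i t := fun k => by
  simpa only [coeff_add] using AlgObtainable.add _ _ (hp k) (hq k)

theorem neg (hp : PolyObtainable J B p) : PolyObtainable J B fun i t => -p i t := fun k => by
  simpa only [coeff_neg] using (hp k).neg

theorem mul (hp : PolyObtainable J B p) (hq : PolyObtainable J B q) :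
    PolyObtainable J B fun i t => p i t * q i t := fun k => by
  simpa only [coeff_mul] using
    AlgObtainable.sum (antidiagonal k) fun a _ => AlgObtainable.mul _ _ (hp a.1) (hq a.2)

theorem pow (hp : PolyObtainable J B p) (m : ℕ) : PolyObtainable J B fun i t => p i t ^ m := by
  induction m with
  | zero => simpa only [pow_zero] using const 1
  | succ m ih => simpa only [pow_succ] using ih.mul hp

theorem sum {α : Type*} (S : Finset α) {p : α → ι → ℝ → ℂ[X]} (hp : ∀ a, PolyObtainable J B (p a)) :
    PolyObtainable J B fun i t => ∑ a ∈ S, p a i t := fun k => by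
  simpa only [finsetSum_coeff] using AlgObtainable.sum S fun a _ => hp a k

theorem prod {α : Type*} (S : Finset α) {p : α → ι → ℝ → ℂ[X]}
    (hp : ∀ a, PolyObtainable J B (p a)) : PolyObtainable J B fun i t => ∏ a ∈ S, p a i t := by
  classical
  induction S using Finset.induction_on with
  | empty => simpa only [prod_empty] using const 1
  | insert a S ha ih => simpa only [prod_insert ha] using (hp a).mul ih

theorem X_sub_C {g : ι → ℝ → ℂ} (hg : AlgObtainable J B g) :
    PolyObtainable J B fun i t => X - Polynomial.C (g i t) := by
  simpa only [sub_eq_add_neg] using (const X).add (C hg).neg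

end PolyObtainable

/-! ### Zeros as algebraic functions of the coefficients -/

theorem fderiv_firstCoeffs_apply {N m₁ : ℕ} (x v : Fin N → ℂ) (j : Fin N) :
    fderiv ℝ (firstCoeffs m₁) x v j =
      ((m₁ : ℂ[X]) * (X - C (ent x 1)) ^ (m₁ - 1) * (-C (ent v 1))
          * ∏ k ∈ Icc 1 N, (X - C (ent x k))
        + (X - C (ent x 1)) ^ m₁
          * -∑ k ∈ Icc 1 N, C (ent v k) * ∏ l ∈ (Icc 1 N).erase k, (X - C (ent x l))).coeff
        (N + m₁ - (j + 1)) := by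
  set c : ℝ → Fin N → ℂ := fun s => x + s • v with hc
  have hc1 : ∀ s, HasDerivAt c v s := fun s => by
    have h1 : HasDerivAt (fun s : ℝ => s • v) ((1 : ℝ) • v) s := (hasDerivAt_id s).smul_const v
    exact (h1.const_add x).congr_deriv (one_smul ℝ v)
  have hd : deriv c = fun _ => v := funext fun s => (hc1 s).deriv
  have e0 : c 0 = x := by simp [hc]
  have hx : ∀ k, HasJet (fun s => ent (c s) k) 0 (ent x k) (ent v k) (ent (deriv (deriv c) 0) k) := by
    intro k
    have := hasJet_ent (x := c) (t := 0) (Eventually.of_forall fun s => (hc1 s).differentiableAt)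
      (by rw [hd]; exact differentiableAt_const v) k
    rw [e0, congrFun hd 0] at this
    exact this
  obtain ⟨P, hP⟩ := HasPolyJet.prod_X_sub_C (Icc 1 N) fun k _ => hx k
  have hjet := (((HasPolyJet.X_sub_C (hx 1)).pow m₁).mul hP) (N + m₁ - (j + 1))
  have hder := hasDerivAt_pi.mp (deriv_firstCoeffs_comp (m₁ := m₁) (hc1 0).differentiableAt) j
  rw [e0, congrFun hd 0] at hder
  rw [← hder.deriv, ← hjet.2.2.1]
  congr 1
  funext s
  rw [firstCoeffs, rootPoly_eq]

/-- The zero x_1 has multiplicity at least `m₁ + 1`. -/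
theorem hasseDeriv_rootPoly_eval {N : ℕ} (hN : 1 ≤ N) (m₁ : ℕ) (x : Fin N → ℂ) :
    (hasseDeriv m₁ (rootPoly m₁ x)).eval (ent x 1) = 0 := by
  rw [rootPoly_eq, pow_mul_prod_Icc hN m₁ (ent x), ← taylor_coeff]
  have hX : taylorAlgHom (ent x 1) (X - C (ent x 1)) = X := by
    change taylor _ _ = _
    rw [map_sub, taylor_X, taylor_C]; simp
  change (taylorAlgHom (ent x 1) _).coeff m₁ = 0
  rw [map_mul, map_pow, hX, coeff_X_pow_mul', if_neg (by omega)]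

section

variable {N m₁ : ℕ} {ι : Type*} {J : ι → Set ℝ} {B : Set (ι → ℝ → ℂ)} {x : ι → ℝ → Fin N → ℂ}

theorem algObtainable_ent {g : ι → ℝ → Fin N → ℂ}
    (hg : ∀ k, AlgObtainable J B fun i t => g i t k) (k : ℕ) :
    AlgObtainable J B fun i t => ent (g i t) k := by
  by_cases hk : 1 ≤ k ∧ k ≤ N
  · simpa only [ent, dif_pos hk] using hg _
  · simpa only [ent, dif_neg hk] using AlgObtainable.const 0

theorem algObtainable_firstCoeffs (hx : ∀ k, AlgObtainable J B fun i t => x i t k) (j : Fin N) :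
    AlgObtainable J B fun i t => firstCoeffs m₁ (x i t) j := by
  have hx' := algObtainable_ent hx
  simp only [firstCoeffs, rootPoly_eq]
  exact ((PolyObtainable.X_sub_C (hx' 1)).pow m₁).mul
    (PolyObtainable.prod _ fun k => PolyObtainable.X_sub_C (hx' k)) _

theorem algObtainable_fderiv_firstCoeffs {v : ι → ℝ → Fin N → ℂ}
    (hx : ∀ k, AlgObtainable J B fun i t => x i t k)
    (hv : ∀ k, AlgObtainable J B fun i t => v i t k) (j : Fin N) :
    AlgObtainable J B fun i t => fderiv ℝ (firstCoeffs m₁) (x i t) (v i t) j := by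
  have hx' := algObtainable_ent hx
  have hv' := algObtainable_ent hv
  simp only [fderiv_firstCoeffs_apply]
  have hX := fun k => PolyObtainable.X_sub_C (hx' k)
  exact (((((PolyObtainable.const (m₁ : ℂ[X])).mul ((hX 1).pow (m₁ - 1))).mul
    (PolyObtainable.C (hv' 1)).neg).mul (PolyObtainable.prod _ hX)).add
    (((hX 1).pow m₁).mul (PolyObtainable.sum _ fun k =>
      (PolyObtainable.C (hv' k)).mul (PolyObtainable.prod _ hX)).neg)) _

/-- The zeros are obtained by algebraic operations from the first `N` coefficients. -/
theorem algObtainable_of_firstCoeffs (hN : 1 ≤ N)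
    (hcont : ∀ i, ∀ t ∈ J i, ContinuousAt (x i) t)
    (hy : ∀ j, AlgObtainable J B fun i t => firstCoeffs m₁ (x i t) j) (n : Fin N) :
    AlgObtainable J B fun i t => x i t n := by
  have hlead : ∀ z : Fin N → ℂ, (rootPoly m₁ z).coeff (N + m₁) = 1 := fun z => by
    have h := monic_natDegree_pow_mul (N := N) m₁ (ent z)
    rw [← rootPoly_eq] at h
    rw [← h.2]; exact h.1
  have hcoeff : ∀ j, j ≤ N → AlgObtainable J B fun i t => (rootPoly m₁ (x i t)).coeff (N + m₁ - j) := by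
    intro j hj
    rcases j with _ | j
    · simpa only [Nat.sub_zero, hlead] using AlgObtainable.const 1
    · exact hy ⟨j, hj⟩
  have hcomp : ∀ k : Fin N, ∀ i, ContinuousOn (fun t => x i t k) (J i) := fun k i t ht =>
    ((continuous_apply k).continuousAt.comp (hcont i t ht)).continuousWithinAt
  have hfirst : AlgObtainable J B fun i t => ent (x i t) 1 := by
    obtain ⟨i₁, -, hi₁⟩ := exists_ent (N := N) (k := 1) (by rw [mem_Icc]; omega)
    have hb : ((N + m₁).choose m₁ : ℂ) ≠ 0 :=
      Nat.cast_ne_zero.mpr (Nat.choose_pos (by omega)).ne'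
    -- The monic equation for x_1 is the `m₁`-th Hasse derivative of ψ divided by its leading
    -- coefficient `(N + m₁).choose m₁`. The index `N + m₁ - (N - k)` is `k + m₁`, in the form that
    -- `hcoeff` covers.
    refine AlgObtainable.root N (fun k i t => ((((k : ℕ) + m₁).choose m₁ : ℂ)
        * ((N + m₁).choose m₁ : ℂ)⁻¹) * (rootPoly m₁ (x i t)).coeff (N + m₁ - (N - k)))
      (fun k => .mul _ _ (.const _) (hcoeff _ (Nat.sub_le _ _))) _ (fun i => ?_) fun i t _ => ?_
    · simpa only [hi₁] using hcomp i₁ i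
    · have h0 := hasseDeriv_rootPoly_eval hN m₁ (x i t)
      have hdeg : (rootPoly m₁ (x i t)).natDegree < N + 1 + m₁ := by
        rw [rootPoly_eq, (monic_natDegree_pow_mul m₁ (ent (x i t))).2]; omega
      rw [hasseDeriv_eval_eq_sum m₁ hdeg (by omega), sum_range_succ, hlead] at h0
      rw [Fin.sum_univ_eq_sum_range (fun k => (((k + m₁).choose m₁ : ℂ)
        * ((N + m₁).choose m₁ : ℂ)⁻¹) * (rootPoly m₁ (x i t)).coeff (N + m₁ - (N - k))
        * ent (x i t) 1 ^ k) N]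
      have hs : ∑ k ∈ range N, (((k + m₁).choose m₁ : ℂ)
          * ((N + m₁).choose m₁ : ℂ)⁻¹) * (rootPoly m₁ (x i t)).coeff (N + m₁ - (N - k))
          * ent (x i t) 1 ^ k
          = ((N + m₁).choose m₁ : ℂ)⁻¹ * ∑ k ∈ range N, ((k + m₁).choose m₁ : ℂ)
            * (rootPoly m₁ (x i t)).coeff (k + m₁) * ent (x i t) 1 ^ k := by
        rw [mul_sum]
        refine sum_congr rfl fun k hk => ?_
        rw [mem_range] at hk
        rw [show N + m₁ - (N - k) = k + m₁ by omega]
        ring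
      rw [hs, eq_neg_of_add_eq_zero_left h0]
      field_simp
      ring
  have hdegφ : ∀ z : Fin N → ℂ, (∏ k ∈ Icc 1 N, (X - C (ent z k))).natDegree = N := fun z => by
    rw [natDegree_prod_X_sub_C]; simp
  -- With x_1 available, dividing out `(X - x_1) ^ m₁` makes the coefficients of φ obtainable, and
  -- x_n is a root of φ.
  refine AlgObtainable.root N (fun k i t => (∏ l ∈ Icc 1 N, (X - C (ent (x i t) l))).coeff k)
    (fun k => ?_) _ (hcomp n) fun i t _ => ?_
  · have hk : (k : ℕ) = N - (N - k) := by have := k.isLt; omega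
    have he : ∀ i t, (∏ l ∈ Icc 1 N, (X - C (ent (x i t) l))).coeff k
        = ∑ j ∈ range (N - k + 1), (negBinom m₁ (N - k - j) : ℂ) * ent (x i t) 1 ^ (N - k - j)
          * (rootPoly m₁ (x i t)).coeff (N + m₁ - j) := fun i t => by
      rw [hk, coeff_of_mul_X_sub_C_pow m₁ (ent (x i t) 1) _ (hdegφ (x i t)).le (Nat.sub_le N k),
        ← rootPoly_eq, ← hk]
    simp only [he]
    refine AlgObtainable.sum _ fun j hj => ?_
    rw [mem_range] at hj
    exact .mul _ _ (.mul _ _ (.const _) (hfirst.pow _)) (hcoeff j (by omega))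
  · have h0 : (∏ l ∈ Icc 1 N, (X - C (ent (x i t) l))).eval (x i t n) = 0 := by
      rw [eval_prod]
      refine prod_eq_zero (i := (n : ℕ) + 1) (by rw [mem_Icc]; omega) ?_
      rw [ent_succ]; simp
    have hmon := monic_prod_X_sub_C (S := Icc 1 N) (ent (x i t))
    rw [eval_eq_sum_range, sum_range_succ, hmon.coeff_natDegree, hdegφ, one_mul] at h0
    rw [Fin.sum_univ_eq_sum_range (fun k : ℕ => (∏ l ∈ Icc 1 N,
      (X - C (ent (x i t) l) : ℂ[X])).coeff k * x i t n ^ k) N, add_comm]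
    exact h0

end

/-! ### Transfer of algebraic solvability -/

theorem algebraicallySolvable_nBody {N m₁ : ℕ} (hN : 1 ≤ N) (hm : 1 ≤ m₁) {K : Set (ℝ → ℝ → ℂ)}
    {U : Set ((Fin N → ℂ) × (Fin N → ℂ))} {f : (Fin N → ℂ) → (Fin N → ℂ) → (Fin N → ℂ)}
    (H : AlgebraicallySolvable K U f) :
    AlgebraicallySolvable K (nBodyDomain m₁ U) (nBodyField m₁ f) where
  exists_solution t₀ x₀ v₀ hmem := by
    rw [mem_nBodyDomain] at hmem
    obtain ⟨T, h1, h2, h3⟩ := H.exists_solution t₀ _ _ hmem.2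
    exact exists_nBody_solution hm hmem.1 T h1 h2 h3
  unique_solution T T' h0 hz hdz := by
    have hdiff := fun (T : Trajectory (nBodyDomain m₁ U) (nBodyField m₁ f)) t (ht : t ∈ T.J) =>
      (T.sol t ht).2.1
    have hy := H.unique_solution (coeffTrajectory hm T) (coeffTrajectory hm T') h0
      (congrArg (firstCoeffs m₁) hz) (by
        change deriv (fun s => firstCoeffs m₁ (T.z s)) T.t₀
          = deriv (fun s => firstCoeffs m₁ (T'.z s)) T'.t₀
        rw [(deriv_firstCoeffs_comp (hdiff T _ T.mem)).deriv,
          (deriv_firstCoeffs_comp (hdiff T' _ T'.mem)).deriv, hz, hdz])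
    exact eqOn_of_firstCoeffs_eqOn hm (T.isOpen.inter T'.isOpen)
      (T.ordConnected.inter T'.ordConnected)
      (fun t ht => (hdiff T t ht.1).continuousAt) (fun t ht => (hdiff T' t ht.2).continuousAt)
      (fun t ht => (T.sol t ht.1).1.1) hy ⟨T.mem, h0 ▸ T'.mem⟩ (by rw [hz, ← h0])
  algebraic := by
    refine algObtainable_of_firstCoeffs (m₁ := m₁) hN
      (fun T t ht => (T.sol t ht).2.1.continuousAt) fun j => ?_
    refine AlgObtainable.comap (J' := fun T : Trajectory U f => T.J) (coeffTrajectory hm)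
      (fun _ => rfl) ?_ (H.algebraic j)
    have hx : ∀ k, AlgObtainable (fun T : Trajectory (nBodyDomain m₁ U) (nBodyField m₁ f) => T.J)
        (initialData K _ _) fun T _ => T.z T.t₀ k := fun k => .base _ (Or.inr (Or.inl ⟨k, rfl⟩))
    have hv : ∀ k, AlgObtainable (fun T : Trajectory (nBodyDomain m₁ U) (nBodyField m₁ f) => T.J)
        (initialData K _ _) fun T _ => (deriv T.z T.t₀ : Fin N → ℂ) k :=
      fun k => .base _ (Or.inr (Or.inr ⟨k, rfl⟩))
    -- Known functions are unchanged, since the initial time is preserved; y(t₀) and ẏ(t₀) are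
    -- polynomials in x(t₀) and ẋ(t₀).
    rintro g (⟨κ, hκ, rfl⟩ | ⟨k, rfl⟩ | ⟨k, rfl⟩)
    · exact .base _ (Or.inl ⟨κ, hκ, rfl⟩)
    · exact algObtainable_firstCoeffs hx k
    · have he : ∀ T : Trajectory (nBodyDomain m₁ U) (nBodyField m₁ f),
          deriv (coeffTrajectory hm T).z (coeffTrajectory hm T).t₀
            = fderiv ℝ (firstCoeffs m₁) (T.z T.t₀) (deriv T.z T.t₀) := fun T =>
        (deriv_firstCoeffs_comp (T.sol T.t₀ T.mem).2.1).deriv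
      simp only [he]
      exact algObtainable_fderiv_firstCoeffs hx hv k

end MultipleRoot

theorem theorem2 (N m₁ : ℕ) (hN : 2 ≤ N) (hm : 1 ≤ m₁) :
    -- the formulas for the second derivatives of the zeros
    (∀ (I : Set ℝ), IsOpen I → ∀ (x y : ℝ → Fin N → ℂ),
      (∀ t ∈ I, Function.Injective (x t)) →
      (∀ t ∈ I, DifferentiableAt ℝ x t) →
      (∀ t ∈ I, DifferentiableAt ℝ (deriv x) t) →
      (∀ t ∈ I, y t = MultipleRoot.firstCoeffs m₁ (x t)) →
      ∀ t ∈ I, DifferentiableAt ℝ y t ∧ DifferentiableAt ℝ (deriv y) t ∧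
        deriv (deriv x) t =
          MultipleRoot.h m₁ (x t) (deriv x t) (y t) (deriv y t) (deriv (deriv y) t)) ∧
    -- solvability of the induced `N`-body problem
    (∀ (K : Set (ℝ → ℝ → ℂ)) (U : Set ((Fin N → ℂ) × (Fin N → ℂ)))
      (f : (Fin N → ℂ) → (Fin N → ℂ) → (Fin N → ℂ)),
      MultipleRoot.AlgebraicallySolvable K U f →
      MultipleRoot.AlgebraicallySolvable K (MultipleRoot.nBodyDomain m₁ U)
        (MultipleRoot.nBodyField m₁ f)) := by
  refine ⟨fun I hI x y hinj hx hx2 hxy t ht => ?_, fun K U f H =>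
    MultipleRoot.algebraicallySolvable_nBody (by omega) hm H⟩
  have hnear : ∀ᶠ s in nhds t, s ∈ I := hI.mem_nhds ht
  have hxev : ∀ᶠ s in nhds t, DifferentiableAt ℝ x s := hnear.mono hx
  have he : y =ᶠ[nhds t] fun s => MultipleRoot.firstCoeffs m₁ (x s) := hnear.mono hxy
  have hV := (MultipleRoot.contDiff_real_firstCoeffs (N := N) m₁).contDiffAt (x := x t)
  have hy1 := MultipleRoot.eventually_hasDerivAt_comp hV hxev
  have hyev : ∀ᶠ s in nhds t, DifferentiableAt ℝ y s := by
    filter_upwards [hy1, he.eventually_nhds] with s hs hs'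
    exact (hs.congr_of_eventuallyEq hs').differentiableAt
  have hy2 : DifferentiableAt ℝ (deriv y) t :=
    (MultipleRoot.hasDerivAt_deriv_comp hV hxev (hx2 t ht)).differentiableAt.congr_of_eventuallyEq
      he.deriv
  exact ⟨hyev.self_of_nhds, hy2,
    MultipleRoot.deriv_deriv_eq_h hm (hinj t ht) hxev (hx2 t ht) hyev hy2 he⟩
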